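/- Let $\mathcal H$ be a separable complex Hilbert space with $\dim\mathcal H>1$ (finite or infinite-dimensional) and let $(e_i)_{i\in\Theta}$ be an orthonormal basis of $\mathcal H$. Let $(\omega_i)_{i\in\Theta}$ be strictly positive real numbers with $\sum_{i\in\Theta}\omega_i=1$. Let $\mathcal F(\mathcal H)=\bigoplus_{n\ge 0}\mathcal H^{\otimes n}$ be the full Fock space with vacuum vector $\Omega$, let $l_i\eta=e_i\otimes\eta$ and $r_i\eta=\eta\otimes e_i$ be the left and right creation operators, and for a finite sequence $I=i_1\cdots i_k$ in $\Theta$ put $e_I=e_{i_1}\otimes\cdots\otimes e_{i_k}$ (with $e_I=\Omega$ if $I$ is empty). Define $P_\omega(x)=\sum_{i\in\Theta}\omega_i\,l_i^*xl_i$ for $x\in B(\mathcal F(\mathcal H))$ and $$H^\infty=\{x\in B(\mathcal F(\mathcal H)):P_\omega(x)=x\},\qquad x\circ y=E(xy)\quad(x,y\in H^\infty),\qquad E(x)=\lim_{n\to\kappa}\frac1n\sum_{k=0}^{n-1}P_\omega^k(x),$$ where $\kappa$ is any free ultrafilter on $\mathbb N$ and the limit is taken in the weak operator topology. Then $H^\infty$,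 with the product $\circ$ (the Choi–Effros product) and the adjoint and norm of $B(\mathcal F(\mathcal H))$, is an (abstract) von Neumann algebra, that is, a $C^*$-algebra with a Banach space predual, and it is an infinite factor: its center consists of the scalar multiples of $1$, and there is $v\in H^\infty$ with $v^*\circ v=1$ and $v\circ v^*\ne1$. More precisely, if $x\in H^\infty$ satisfies $x\circ y=y\circ x$ for all $y\in H^\infty$, then $\langle xe_I,e_J\rangle=\delta_{I,J}\langle x\Omega,\Omega\rangle$ for all finite sequences $I,J$ in $\Theta$, and hence $x=\langle x\Omega,\Omega\rangle 1$. Moreover, for every $i\in\Theta$ we have $r_i,r_i^*\in H^\infty$, $r_i^*\circ r_i=1$ and $r_i\circ r_i^*\neq1$. -/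

import Mathlib

open scoped TensorProduct InnerProductSpace

universe u

noncomputable section

/-! ### Hilbert tensor powers and the full Fock space -/

/-- A bundled complex Hilbert space, used only to iterate the Hilbert tensor product. -/
structure HilbertBundle : Type (u + 1) where
  carrier : Type u
  [instNormed : NormedAddCommGroup carrier]
  [instInner : InnerProductSpace ℂ carrier]
  [instComplete : CompleteSpace carrier]

attribute [instance] HilbertBundle.instNormed HilbertBundle.instInner HilbertBundle.instComplete

section TensorPowers

variable (H : Type u) [NormedAddCommGroup H] [InnerProductSpace ℂ H]

/-- `H^{⊗0}` is the one-dimensional Hilbert space, and `H^{⊗(n+1)}` is the Hilbert tensor product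
(the completion of the algebraic tensor product for its inner product) of `H` with `H^{⊗n}`. -/
def tensorPowBundle : ℕ → HilbertBundle.{u}
  | 0 => ⟨EuclideanSpace ℂ PUnit.{u + 1}⟩
  | n + 1 => ⟨UniformSpace.Completion (H ⊗[ℂ] (tensorPowBundle n).carrier)⟩

/-- The `n`-fold Hilbert tensor power `H^{⊗n}`. -/
abbrev TensorPow (n : ℕ) : Type u := (tensorPowBundle H n).carrier

/-- The full Fock space over `H`: the Hilbert direct sum of the `H^{⊗n}`, `n ≥ 0`. -/
def FockSpace : Type u := lp (fun n : ℕ => TensorPow H n) 2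

instance instNormedAddCommGroupFockSpace : NormedAddCommGroup (FockSpace H) :=
  inferInstanceAs (NormedAddCommGroup (lp (fun n : ℕ => TensorPow H n) 2))

instance instInnerProductSpaceFockSpace : InnerProductSpace ℂ (FockSpace H) :=
  inferInstanceAs (InnerProductSpace ℂ (lp (fun n : ℕ => TensorPow H n) 2))

instance instCompleteSpaceFockSpace : CompleteSpace (FockSpace H) :=
  inferInstanceAs (CompleteSpace (lp (fun n : ℕ => TensorPow H n) 2))

/-- The vacuum vector `Ω`, the unit vector of `H^{⊗0}`. -/
def vacuum : FockSpace H :=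
  (lp.single 2 0 (EuclideanSpace.single PUnit.unit (1 : ℂ) : EuclideanSpace ℂ PUnit.{u + 1}) :
    lp (fun n : ℕ => TensorPow H n) 2)

end TensorPowers

/-! ### Creation operators -/

section Shift

variable {G : ℕ → Type u} [hG : (n : ℕ) → NormedAddCommGroup (G n)]
  [hI : (n : ℕ) → InnerProductSpace ℂ (G n)]

/-- The sequence `(0, A₀ x₀, A₁ x₁, …)`. -/
def shiftSeq (A : (n : ℕ) → G n →L[ℂ] G (n + 1)) (x : (n : ℕ) → G n) : (n : ℕ) → G n
  | 0 => 0
  | n + 1 => A n (x n)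

theorem shiftSeq_bound (A : (n : ℕ) → G n →L[ℂ] G (n + 1)) (C : ℝ) (hA : ∀ n, ‖A n‖ ≤ C)
    (x : lp G 2) :
    (Summable fun n => ‖shiftSeq A x n‖ ^ (2 : ENNReal).toReal) ∧
      ∑' n, ‖shiftSeq A x n‖ ^ (2 : ENNReal).toReal ≤ (C * ‖x‖) ^ (2 : ENNReal).toReal := by
  have hC : 0 ≤ C := (norm_nonneg _).trans (hA 0)
  have h2 : 0 < (2 : ENNReal).toReal := by simp
  have hx := (lp.hasSum_norm h2 x).mul_left (C ^ (2 : ENNReal).toReal)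
  have hle : ∀ n, ‖A n (x n)‖ ^ (2 : ENNReal).toReal ≤
      C ^ (2 : ENNReal).toReal * ‖x n‖ ^ (2 : ENNReal).toReal := by
    intro n
    rw [← Real.mul_rpow hC (norm_nonneg _)]
    exact Real.rpow_le_rpow (norm_nonneg _) ((A n).le_of_opNorm_le (hA n) _) h2.le
  have hs : Summable (fun n : ℕ => ‖A n (x n)‖ ^ (2 : ENNReal).toReal) :=
    Summable.of_nonneg_of_le (fun n => by positivity) hle hx.summable
  have hs' : Summable fun n => ‖shiftSeq A x n‖ ^ (2 : ENNReal).toReal :=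
    (summable_nat_add_iff 1).1 hs
  refine ⟨hs', ?_⟩
  have h0 := hs'.sum_add_tsum_nat_add 1
  simp only [Finset.range_one, Finset.sum_singleton] at h0
  rw [Real.mul_rpow hC (norm_nonneg _), ← hx.tsum_eq, ← h0]
  simpa [shiftSeq] using hs.tsum_le_tsum hle hx.summable

/-- Operators `A n : G n → G (n+1)` of norm at most `C` induce a bounded operator on the Hilbert
direct sum, namely `(x₀, x₁, x₂, …) ↦ (0, A₀ x₀, A₁ x₁, …)`. -/
def hilbertSumShift (A : (n : ℕ) → G n →L[ℂ] G (n + 1)) (C : ℝ) (hA : ∀ n, ‖A n‖ ≤ C) :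
    lp G 2 →L[ℂ] lp G 2 :=
  LinearMap.mkContinuous
    { toFun := fun x =>
        ⟨shiftSeq A x, (memℓp_gen_iff (by simp)).2 (shiftSeq_bound A C hA x).1⟩
      map_add' := by
        intro x y
        ext n
        cases n with
        | zero => exact (add_zero (0 : G 0)).symm
        | succ m => exact (A m).map_add (x m) (y m)
      map_smul' := by
        intro c x
        ext n
        cases n with
        | zero => simp [shiftSeq]
        | succ m => simp [shiftSeq] } C (by
    intro x
    have hC : 0 ≤ C := (norm_nonneg _).trans (hA 0)
    have h2 : 0 < (2 : ENNReal).toReal := by simp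
    rw [← Real.rpow_le_rpow_iff (norm_nonneg _) (by positivity) h2, lp.norm_rpow_eq_tsum h2]
    exact (shiftSeq_bound A C hA x).2)

end Shift

section Creation

variable {H : Type u} [NormedAddCommGroup H] [InnerProductSpace ℂ H]

/-- `η ↦ ξ ⊗ η` as an operator `H^{⊗n} → H^{⊗(n+1)}`. -/
def leftTensor (ξ : H) (n : ℕ) : TensorPow H n →L[ℂ] TensorPow H (n + 1) :=
  (UniformSpace.Completion.toComplL : H ⊗[ℂ] TensorPow H n →L[ℂ] _) ∘L
    TensorProduct.mkL ℂ H (TensorPow H n) ξ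

/-- `η ↦ η ⊗ ξ` as an operator `H^{⊗n} → H^{⊗(n+1)}`: on scalars `z ⊗ ξ = ξ ⊗ z`, and
`(ζ ⊗ η) ⊗ ξ = ζ ⊗ (η ⊗ ξ)`. -/
def rightTensor (ξ : H) : (n : ℕ) → TensorPow H n →L[ℂ] TensorPow H (n + 1)
  | 0 => leftTensor ξ 0
  | n + 1 => ((rightTensor ξ n).lTensor H).completion

theorem norm_leftTensor_le (ξ : H) (n : ℕ) : ‖leftTensor ξ n‖ ≤ ‖ξ‖ := by
  refine ContinuousLinearMap.opNorm_le_bound _ (norm_nonneg _) fun x => le_of_eq ?_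
  exact (UniformSpace.Completion.norm_coe _).trans (TensorProduct.norm_tmul ξ x)

theorem norm_completion_apply_le {E F : Type*} [NormedAddCommGroup E] [NormedSpace ℂ E]
    [NormedAddCommGroup F] [NormedSpace ℂ F] (f : E →L[ℂ] F) (x : UniformSpace.Completion E) :
    ‖f.completion x‖ ≤ ‖f‖ * ‖x‖ := by
  induction x using UniformSpace.Completion.induction_on with
  | hp => exact isClosed_le (by fun_prop) (by fun_prop)
  | ih a =>
    rw [ContinuousLinearMap.completion_apply_coe, UniformSpace.Completion.norm_coe,
      UniformSpace.Completion.norm_coe]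
    exact f.le_opNorm a

theorem norm_rightTensor_le (ξ : H) (n : ℕ) : ‖rightTensor ξ n‖ ≤ ‖ξ‖ := by
  induction n with
  | zero => exact norm_leftTensor_le ξ 0
  | succ n ih =>
    refine ContinuousLinearMap.opNorm_le_bound _ (norm_nonneg _) fun x => ?_
    exact (norm_completion_apply_le _ x).trans (mul_le_mul_of_nonneg_right
      ((ContinuousLinearMap.norm_lTensor_le H (rightTensor ξ n)).trans ih) (norm_nonneg x))

/-- The left creation operator `l_ξ η = ξ ⊗ η` on the full Fock space. -/
def leftCreation (ξ : H) : FockSpace H →L[ℂ] FockSpace H :=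
  hilbertSumShift (G := TensorPow H) (leftTensor ξ) ‖ξ‖ (norm_leftTensor_le ξ)

/-- The right creation operator `r_ξ η = η ⊗ ξ` on the full Fock space. -/
def rightCreation (ξ : H) : FockSpace H →L[ℂ] FockSpace H :=
  hilbertSumShift (G := TensorPow H) (rightTensor ξ) ‖ξ‖ (norm_rightTensor_le ξ)

/-- The simple basis element `e_I = e_{i₁} ⊗ ⋯ ⊗ e_{i_k}` attached to a finite sequence
`I = i₁ ⋯ i_k`; it is the vacuum vector for the empty sequence. -/
def simpleBasisVec {Θ : Type*} (e : Θ → H) : List Θ → FockSpace H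
  | [] => vacuum H
  | i :: I => leftCreation (e i) (simpleBasisVec e I)

end Creation

/-! ### Harmonic elements and the Choi–Effros product -/

section Poisson

variable {K : Type u} [NormedAddCommGroup K] [InnerProductSpace ℂ K] [CompleteSpace K]

/-- The space `H^∞(B(K), P) = {x | P x = x}` of `P`-harmonic elements, with the operator norm. -/
def poissonBoundary (P : (K →L[ℂ] K) →L[ℂ] (K →L[ℂ] K)) : Submodule ℂ (K →L[ℂ] K) where
  carrier := {x | P x = x}
  add_mem' := by
    intro x y hx hy
    simp only [Set.mem_ofPred_eq] at hx hy ⊢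
    rw [map_add, hx, hy]
  zero_mem' := map_zero P
  smul_mem' := by
    intro c x hx
    simp only [Set.mem_ofPred_eq] at hx ⊢
    rw [map_smul, hx]

/-- `E(x) = lim_{n → κ} (1/n) ∑_{k < n} P^k(x)`, the limit being taken in the weak operator topology
along the ultrafilter `κ`. (The means are norm bounded when `P` is a contraction, so that the limit
exists; it is unique, the weak operator topology being Hausdorff.) -/
def harmonicProjection (κ : Ultrafilter ℕ) (P : (K →L[ℂ] K) →L[ℂ] (K →L[ℂ] K))
    (x : K →L[ℂ] K) : K →L[ℂ] K :=
  (Filter.limUnder (κ : Filter ℕ) fun n : ℕ =>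
    ContinuousLinearMapWOT.ofCLM ((n : ℂ)⁻¹ • ∑ k ∈ Finset.range n, (P ^ k) x)).toCLM

/-- The Choi–Effros product `x ∘ y = E(x y)`. -/
def choiEffros (κ : Ultrafilter ℕ) (P : (K →L[ℂ] K) →L[ℂ] (K →L[ℂ] K)) (x y : K →L[ℂ] K) :
    K →L[ℂ] K :=
  harmonicProjection κ P (x * y)

/-- The completely positive map `x ↦ a* x a` on `B(K)`. -/
def conjBy (a : K →L[ℂ] K) : (K →L[ℂ] K) →L[ℂ] (K →L[ℂ] K) :=
  (ContinuousLinearMap.mul ℂ (K →L[ℂ] K) (star a)) ∘L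
    ((ContinuousLinearMap.mul ℂ (K →L[ℂ] K)).flip a)

theorem conjBy_apply (a x : K →L[ℂ] K) : conjBy a x = star a * x * a := by
  simp [conjBy, mul_assoc]

end Poisson

section Markov

variable {H : Type u} [NormedAddCommGroup H] [InnerProductSpace ℂ H] {Θ : Type*}

/-- The Markov operator `P_ω(x) = ∑ i, ω_i l_{e_i}* x l_{e_i}` on `B(F(H))`. For positive weights
of sum one and unit vectors `e_i` the series converges absolutely in norm, so a fortiori strongly. -/
def markovOperator (e : Θ → H) (ω : Θ → ℝ) :
    (FockSpace H →L[ℂ] FockSpace H) →L[ℂ] (FockSpace H →L[ℂ] FockSpace H) :=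
  ∑' i, (ω i : ℂ) • conjBy (leftCreation (e i))

theorem norm_leftCreation_le (ξ : H) : ‖leftCreation ξ‖ ≤ ‖ξ‖ :=
  by
  unfold leftCreation hilbertSumShift
  exact LinearMap.mkContinuous_norm_le _ (norm_nonneg _) _

theorem summable_markovOperator (e : Θ → H) (ω : Θ → ℝ) (he : ∀ i, ‖e i‖ = 1) (hω : Summable ω) (hp : ∀ i, 0 ≤ ω i) :
    Summable fun i => (ω i : ℂ) • conjBy (leftCreation (e i)) := by
  refine Summable.of_norm_bounded hω fun i => ?_
  rw [norm_smul, Complex.norm_real, Real.norm_of_nonneg (hp i)]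
  refine mul_le_of_le_one_right (hp i) ?_
  refine ContinuousLinearMap.opNorm_le_bound _ zero_le_one fun x => ?_
  rw [conjBy_apply]
  have h1 : ‖leftCreation (e i)‖ ≤ 1 := (norm_leftCreation_le _).trans (he i).le
  have h2 : ‖star (leftCreation (e i))‖ ≤ 1 := by
    have := norm_star (leftCreation (e i))
    exact this.le.trans h1
  calc _ ≤ ‖star (leftCreation (e i))‖ * ‖x‖ * ‖leftCreation (e i)‖ :=
        (norm_mul_le _ _).trans (by gcongr; exact norm_mul_le _ _)
    _ ≤ 1 * ‖x‖ * 1 := by gcongr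
    _ = 1 * ‖x‖ := by ring

/-- The defining series of `P_ω(x)` converges in norm. -/
theorem hasSum_markovOperator (e : Θ → H) (ω : Θ → ℝ) (he : ∀ i, ‖e i‖ = 1) (hω : Summable ω) (hp : ∀ i, 0 ≤ ω i)
    (x : FockSpace H →L[ℂ] FockSpace H) :
    HasSum (fun i => (ω i : ℂ) • (star (leftCreation (e i)) * x * leftCreation (e i)))
      (markovOperator e ω x) := by
  have := (summable_markovOperator e ω he hω hp).hasSum.mapL (ContinuousLinearMap.apply ℂ _ x)
  simpa [conjBy_apply] using! this

end Markov

/-! ### Infinite factors -/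

/-- A factor: an (abstract) von Neumann algebra, i.e. a C⋆-algebra with a Banach space predual,
that is nonzero and whose center consists of the scalar multiples of the identity. -/
structure IsFactor (M : Type u) [CStarAlgebra M] : Prop where
  wstar : WStarAlgebra M
  nontrivial : Nontrivial M
  center_eq : Subalgebra.center ℂ M = ⊥

/-- The identity is an infinite projection: it is equivalent to a proper subprojection of itself. -/
def IsInfiniteAlgebra (M : Type u) [CStarAlgebra M] : Prop :=
  ∃ v : M, star v * v = 1 ∧ v * star v ≠ 1

end

noncomputable section

open Filter Topology

/-! ### Weak operator limits -/

section Operators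

variable {K : Type u} [NormedAddCommGroup K] [InnerProductSpace ℂ K] [CompleteSpace K]

/-! Two independent arguments.

The algebra: write P for the Markov operator, a unital positive contraction. Cesàro means are
bounded, so E exists as a weak limit. The means are asymptotically P-invariant along the free
ultrafilter κ and P commutes with the limit, so E is a positive idempotent of norm at most one onto
the harmonic elements. By the Kadison–Schwarz inequality, E(a* a) - E(a)* E(a) is positive. Harmonic
h are null vectors for the resulting form E(a* b) - E(E(a)* E(b)), and a Cauchy–Schwarz argument
yields E(h b) = E(h E(b)) (`harmonicProjection_star_mul`). This gives associativity, and
Kadison–Schwarz for E gives the C*-identity. The predual is the closed span of the vector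
functionals: a bounded functional on the dual restricts on them to a bounded sesquilinear form,
hence to an operator T, and T is harmonic because the relation P x = x can be written on the
functionals as a norm convergent series.

The factor: let p be the projection onto Ω. Since r_i commutes with every l_k, r_i is harmonic and x
∘ r_i = x r_i. From l_k* r_i = r_i l_k* + δ_{ki} p and P(p x) = 0 comes r_i ∘ x = r_i x + ω_i p x
l_i. For central x the two products agree. With φ(I) = ⟪Ω, x e_I⟫ this says φ(I i) = ω_i φ(i I):
moving the last letter to the front costs its weight. Carrying a whole nonempty word around gives
φ(I) = ω_I φ(I), where ω_I is the product of the weights of its letters. There are at least two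
positive weights of sum one, so ω_I < 1 and φ(I) = 0. The same for x* shows that xΩ is a multiple of
Ω, and the relation, now free of its correction term, carries this to every e_I. Finally r_i* ∘ r_i
= r_i* r_i = 1, whereas r_i ∘ r_i* = r_i r_i* + ω_i p has vacuum entry ω_i < 1. -/

theorem exists_clm_of_sesquilinear (f : K → K → ℂ) {C : ℝ} (hC : 0 ≤ C)
    (add_left : ∀ x x' y, f (x + x') y = f x y + f x' y)
    (smul_left : ∀ (c : ℂ) x y, f (c • x) y = starRingEnd ℂ c * f x y)
    (add_right : ∀ x y y', f x (y + y') = f x y + f x y')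
    (smul_right : ∀ (c : ℂ) x y, f x (c • y) = c * f x y)
    (bound : ∀ x y, ‖f x y‖ ≤ C * ‖x‖ * ‖y‖) :
    ∃ T : K →L[ℂ] K, ‖T‖ ≤ C ∧ ∀ x y, ⟪x, T y⟫_ℂ = f x y := by
  let B : K →L⋆[ℂ] K →L[ℂ] ℂ :=
    (LinearMap.mk₂'ₛₗ (starRingEnd ℂ) (RingHom.id ℂ) f add_left smul_left add_right
      smul_right).mkContinuous₂ C bound
  -- The Riesz operator of B represents the form in the first slot; its adjoint represents it in the
  -- second.
  let T := star (InnerProductSpace.continuousLinearMapOfBilin B)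
  have hT : ∀ x y, ⟪x, T y⟫_ℂ = f x y := by
    intro x y
    rw [show T = _ from ContinuousLinearMap.star_eq_adjoint _,
      ContinuousLinearMap.adjoint_inner_right,
      InnerProductSpace.continuousLinearMapOfBilin_apply]
    rfl
  refine ⟨T, ContinuousLinearMap.opNorm_le_bound _ hC fun y => ?_, hT⟩
  rcases eq_or_ne (T y) 0 with h | h
  · rw [h, norm_zero]; positivity
  · have h1 : ‖T y‖ * ‖T y‖ ≤ ‖T y‖ * (C * ‖y‖) := by
      have := bound (T y) y
      rw [← hT, inner_self_eq_norm_sq_to_K] at this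
      norm_num at this
      nlinarith
    exact le_of_mul_le_mul_left h1 (norm_pos_iff.2 h)

omit [CompleteSpace K] in
theorem norm_inner_apply_le (T : K →L[ℂ] K) (x y : K) : ‖⟪x, T y⟫_ℂ‖ ≤ ‖T‖ * ‖x‖ * ‖y‖ :=
  calc ‖⟪x, T y⟫_ℂ‖ ≤ ‖x‖ * ‖T y‖ := norm_inner_le_norm _ _
    _ ≤ ‖x‖ * (‖T‖ * ‖y‖) := by gcongr; exact T.le_opNorm y
    _ = ‖T‖ * ‖x‖ * ‖y‖ := by ring

/-- A bounded sequence of operators converges in the weak operator topology along an ultrafilter. -/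
theorem exists_tendsto_inner_of_bounded (κ : Ultrafilter ℕ) (T : ℕ → K →L[ℂ] K) {C : ℝ}
    (hT : ∀ n, ‖T n‖ ≤ C) :
    ∃ S : K →L[ℂ] K, ‖S‖ ≤ C ∧
      ∀ x y, Tendsto (fun n => ⟪x, T n y⟫_ℂ) κ (𝓝 ⟪x, S y⟫_ℂ) := by
  have hC : 0 ≤ C := (norm_nonneg _).trans (hT 0)
  have hb : ∀ x y n, ‖⟪x, T n y⟫_ℂ‖ ≤ C * ‖x‖ * ‖y‖ := fun x y n =>
    (norm_inner_apply_le _ _ _).trans (by gcongr; exact hT n)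
  have hlim : ∀ x y, ∃ z, Tendsto (fun n => ⟪x, T n y⟫_ℂ) κ (𝓝 z) := by
    intro x y
    -- For fixed x and y the entries stay in a closed disc, which is compact, so they converge along
    -- κ.
    obtain ⟨z, -, hz⟩ := (isCompact_closedBall (0 : ℂ) (C * ‖x‖ * ‖y‖)).ultrafilter_le_nhds
      (κ.map fun n => ⟪x, T n y⟫_ℂ) (by
        rw [le_principal_iff]
        exact Filter.mem_map.2 (Filter.univ_mem' fun n => by simpa using hb x y n))
    exact ⟨z, hz⟩
  choose f hf using hlim
  obtain ⟨S, hS, hSf⟩ := exists_clm_of_sesquilinear f hC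
    (fun x x' y => tendsto_nhds_unique (hf _ _) (by
      simpa only [inner_add_left] using (hf x y).add (hf x' y)))
    (fun c x y => tendsto_nhds_unique (hf _ _) (by
      simpa only [inner_smul_left] using (hf x y).const_mul (starRingEnd ℂ c)))
    (fun x y y' => tendsto_nhds_unique (hf _ _) (by
      simpa only [map_add, inner_add_right] using (hf x y).add (hf x y')))
    (fun c x y => tendsto_nhds_unique (hf _ _) (by
      simpa only [map_smul, inner_smul_right] using (hf x y).const_mul c))
    (fun x y => le_of_tendsto (hf x y).norm (Filter.Eventually.of_forall (hb x y)))
  exact ⟨S, hS, fun x y => by rw [hSf]; exact hf x y⟩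

omit [CompleteSpace K] in
theorem clm_ext_inner {S T : K →L[ℂ] K} (h : ∀ x y, ⟪x, S y⟫_ℂ = ⟪x, T y⟫_ℂ) : S = T :=
  ContinuousLinearMap.ext fun y => ext_inner_left ℂ fun x => h x y

omit [CompleteSpace K] in
theorem clm_ext_inner_self {S T : K →L[ℂ] K} (h : ∀ x, ⟪x, S x⟫_ℂ = ⟪x, T x⟫_ℂ) : S = T := by
  rw [← sub_eq_zero, ← ContinuousLinearMap.coe_inj]
  refine (inner_map_self_eq_zero _).1 fun x => ?_
  rw [← inner_conj_symm]
  simp [inner_sub_right, h x]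

theorem inner_star_mul_self (a b : K →L[ℂ] K) (x y : K) : ⟪x, (star a * b) y⟫_ℂ = ⟪a x, b y⟫_ℂ := by
  rw [ContinuousLinearMap.star_eq_adjoint]
  exact ContinuousLinearMap.adjoint_inner_right a x (b y)

end Operators

/-- `P(x) = ∑ ω_i L_i* x L_i` for isometries `L_i` and nonnegative weights of sum one. -/
structure IsKrausMarkov {K : Type u} [NormedAddCommGroup K] [InnerProductSpace ℂ K]
    [CompleteSpace K] {ι : Type*} (L : ι → K →L[ℂ] K) (ω : ι → ℝ)
    (P : (K →L[ℂ] K) →L[ℂ] (K →L[ℂ] K)) : Prop where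
  nonneg : ∀ i, 0 ≤ ω i
  hasSum_one : HasSum ω 1
  isometry : ∀ i, star (L i) * L i = 1
  hasSum : ∀ x, HasSum (fun i => (ω i : ℂ) • (star (L i) * x * L i)) (P x)

/-! ### Positivity and the Kadison–Schwarz inequality for P and its powers. -/

namespace IsKrausMarkov

variable {K : Type u} [NormedAddCommGroup K] [InnerProductSpace ℂ K] [CompleteSpace K]
  {ι : Type*} {L : ι → K →L[ℂ] K} {ω : ι → ℝ} {P : (K →L[ℂ] K) →L[ℂ] (K →L[ℂ] K)}

theorem inner_isometry (hP : IsKrausMarkov L ω P) (i : ι) (x y : K) :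
    ⟪L i x, L i y⟫_ℂ = ⟪x, y⟫_ℂ := by
  rw [← inner_star_mul_self, hP.isometry]; rfl

theorem norm_isometry (hP : IsKrausMarkov L ω P) (i : ι) (x : K) : ‖L i x‖ = ‖x‖ := by
  rw [@norm_eq_sqrt_re_inner ℂ, hP.inner_isometry, ← @norm_eq_sqrt_re_inner ℂ]

theorem hasSum_inner (hP : IsKrausMarkov L ω P) (a : K →L[ℂ] K) (x y : K) :
    HasSum (fun i => (ω i : ℂ) * ⟪L i x, a (L i y)⟫_ℂ) ⟪x, P a y⟫_ℂ := by
  have := ((hP.hasSum a).mapL (ContinuousLinearMap.apply ℂ K y)).mapL (innerSL ℂ x)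
  simpa [inner_smul_right, mul_assoc, ContinuousLinearMap.star_eq_adjoint,
    ContinuousLinearMap.adjoint_inner_right] using! this

theorem hasSum_re_inner (hP : IsKrausMarkov L ω P) (a : K →L[ℂ] K) (x y : K) :
    HasSum (fun i => ω i * (⟪L i x, a (L i y)⟫_ℂ).re) (⟪x, P a y⟫_ℂ).re := by
  simpa using Complex.hasSum_re (hP.hasSum_inner a x y)

theorem map_one (hP : IsKrausMarkov L ω P) : P 1 = 1 := by
  refine clm_ext_inner fun x y => (hP.hasSum_inner 1 x y).unique ?_
  have := (Complex.hasSum_ofReal.2 hP.hasSum_one).mul_right ⟪x, y⟫_ℂ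
  simpa [hP.inner_isometry] using this

theorem map_star (hP : IsKrausMarkov L ω P) (a : K →L[ℂ] K) : P (star a) = star (P a) := by
  refine (hP.hasSum (star a)).unique ?_
  have := (hP.hasSum a).star
  simpa [mul_assoc] using this

theorem norm_map_le (hP : IsKrausMarkov L ω P) (a : K →L[ℂ] K) : ‖P a‖ ≤ ‖a‖ := by
  have h1 : ∀ i, ‖L i‖ ≤ 1 := fun i =>
    ContinuousLinearMap.opNorm_le_bound _ zero_le_one fun x => by simp [hP.norm_isometry]
  have := (hP.hasSum a).norm_le_of_bounded (hP.hasSum_one.mul_right ‖a‖) fun i => by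
    rw [norm_smul, Complex.norm_real, Real.norm_of_nonneg (hP.nonneg i)]
    refine mul_le_mul_of_nonneg_left ?_ (hP.nonneg i)
    calc ‖star (L i) * a * L i‖ ≤ ‖star (L i)‖ * ‖a‖ * ‖L i‖ :=
          (norm_mul_le _ _).trans (by gcongr; exact norm_mul_le _ _)
      _ ≤ 1 * ‖a‖ * 1 := by
          gcongr
          · rw [norm_star]; exact h1 i
          · exact h1 i
      _ = ‖a‖ := by ring
  simpa using this

theorem re_inner_nonneg (hP : IsKrausMarkov L ω P) {a : K →L[ℂ] K}
    (ha : ∀ x, 0 ≤ (⟪x, a x⟫_ℂ).re) (x : K) : 0 ≤ (⟪x, P a x⟫_ℂ).re :=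
  (hP.hasSum_re_inner a x x).nonneg fun i => mul_nonneg (hP.nonneg i) (ha _)

/-- The Kadison–Schwarz inequality. -/
theorem norm_sq_le (hP : IsKrausMarkov L ω P) (a : K →L[ℂ] K) (x : K) :
    ‖P a x‖ ^ 2 ≤ (⟪x, P (star a * a) x⟫_ℂ).re := by
  set y := P a x with hy
  -- Sum over i, with weights ω i, the inequality 2 Re⟪L i y, a L i x⟫ ≤ ‖a L i x‖² + ‖y‖². As y = P
  -- a x, the left side sums to 2‖y‖², and the weights of sum one leave a single ‖y‖² to cancel.
  have h1 := (hP.hasSum_re_inner a y x).mul_left 2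
  have h2 := (hP.hasSum_re_inner (star a * a) x x).add (hP.hasSum_one.mul_right (‖y‖ ^ 2))
  have h3 := hasSum_le (fun i => ?_) h1 h2
  · rw [← hy] at h3
    have : (⟪y, y⟫_ℂ).re = ‖y‖ ^ 2 := inner_self_eq_norm_sq (𝕜 := ℂ) y
    linarith
  · rw [inner_star_mul_self]
    have h4 : (⟪a (L i x), a (L i x)⟫_ℂ).re = ‖a (L i x)‖ ^ 2 :=
      inner_self_eq_norm_sq (𝕜 := ℂ) _
    have h5 := Complex.re_le_norm ⟪L i y, a (L i x)⟫_ℂ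
    have h6 := norm_inner_le_norm (𝕜 := ℂ) (L i y) (a (L i x))
    rw [hP.norm_isometry] at h6
    rw [h4]
    have h7 := hP.nonneg i
    have : 2 * (⟪L i y, a (L i x)⟫_ℂ).re ≤ ‖a (L i x)‖ ^ 2 + ‖y‖ ^ 2 := by
      nlinarith [sq_nonneg (‖a (L i x)‖ - ‖y‖)]
    nlinarith

theorem pow_succ_apply (k : ℕ) (a : K →L[ℂ] K) : (P ^ (k + 1)) a = P ((P ^ k) a) := by
  rw [pow_succ']; rfl

theorem pow_norm_map_le (hP : IsKrausMarkov L ω P) (k : ℕ) (a : K →L[ℂ] K) :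
    ‖(P ^ k) a‖ ≤ ‖a‖ := by
  induction k with
  | zero => simp
  | succ k ih =>
    rw [pow_succ_apply]
    exact (hP.norm_map_le _).trans ih

theorem pow_map_star (hP : IsKrausMarkov L ω P) (k : ℕ) (a : K →L[ℂ] K) :
    (P ^ k) (star a) = star ((P ^ k) a) := by
  induction k with
  | zero => simp
  | succ k ih => rw [pow_succ_apply, pow_succ_apply, ih, hP.map_star]

/-- With b = P^k a, Kadison–Schwarz for P bounds ‖P b x‖² by ⟪x, P(b* b) x⟫; the induction
hypothesis says b* b ≤ P^k(a* a), and P preserves this order. -/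
theorem pow_norm_sq_le (hP : IsKrausMarkov L ω P) (k : ℕ) (a : K →L[ℂ] K) (x : K) :
    ‖(P ^ k) a x‖ ^ 2 ≤ (⟪x, (P ^ k) (star a * a) x⟫_ℂ).re := by
  induction k generalizing x with
  | zero =>
    change ‖a x‖ ^ 2 ≤ (⟪x, (star a * a) x⟫_ℂ).re
    rw [inner_star_mul_self]
    exact (inner_self_eq_norm_sq (𝕜 := ℂ) (a x)).ge
  | succ k ih =>
    rw [pow_succ_apply, pow_succ_apply]
    refine (hP.norm_sq_le _ x).trans ?_
    have := hP.re_inner_nonneg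
      (a := (P ^ k) (star a * a) - star ((P ^ k) a) * (P ^ k) a) (fun y => ?_) x
    · rw [map_sub, sub_apply, inner_sub_right, Complex.sub_re] at this
      linarith
    · rw [sub_apply, inner_sub_right, Complex.sub_re, inner_star_mul_self]
      have h2 : (⟪((P ^ k) a) y, ((P ^ k) a) y⟫_ℂ).re = ‖((P ^ k) a) y‖ ^ 2 :=
        inner_self_eq_norm_sq (𝕜 := ℂ) _
      linarith [ih y]

end IsKrausMarkov

/-- The Cesàro means `(1/n) ∑_{k < n} P^k(a)`. -/
def cesaroMean {K : Type u} [NormedAddCommGroup K] [InnerProductSpace ℂ K]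
    (P : (K →L[ℂ] K) →L[ℂ] (K →L[ℂ] K)) (n : ℕ) (a : K →L[ℂ] K) : K →L[ℂ] K :=
  (n : ℂ)⁻¹ • ∑ k ∈ Finset.range n, (P ^ k) a

theorem mem_poissonBoundary {K : Type u} [NormedAddCommGroup K] [InnerProductSpace ℂ K]
    [CompleteSpace K] {P : (K →L[ℂ] K) →L[ℂ] (K →L[ℂ] K)} {a : K →L[ℂ] K} :
    a ∈ poissonBoundary P ↔ P a = a := Iff.rfl

/-! ### The Cesàro limit E and the Choi–Effros identities. -/

namespace IsKrausMarkov

variable {K : Type u} [NormedAddCommGroup K] [InnerProductSpace ℂ K] [CompleteSpace K]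
  {ι : Type*} {L : ι → K →L[ℂ] K} {ω : ι → ℝ} {P : (K →L[ℂ] K) →L[ℂ] (K →L[ℂ] K)}

theorem norm_cesaroMean_le (hP : IsKrausMarkov L ω P) (n : ℕ) (a : K →L[ℂ] K) :
    ‖cesaroMean P n a‖ ≤ ‖a‖ := by
  rcases n.eq_zero_or_pos with rfl | hn
  · simp [cesaroMean]
  · have hn' : (0 : ℝ) < n := by exact_mod_cast hn
    rw [cesaroMean, norm_smul, norm_inv, Complex.norm_natCast, inv_mul_le_iff₀ hn']
    refine (norm_sum_le _ _).trans ?_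
    refine (Finset.sum_le_sum fun k _ => hP.pow_norm_map_le k a).trans ?_
    simp

/-- A `limUnder` has content only once convergence is known. Boundedness of the means supplies it,
and every later property of E is read off from these limits of matrix entries. -/
theorem harmonicProjection_spec (hP : IsKrausMarkov L ω P) (κ : Ultrafilter ℕ) (a : K →L[ℂ] K) :
    ‖harmonicProjection κ P a‖ ≤ ‖a‖ ∧
      ∀ x y, Tendsto (fun n => ⟪x, cesaroMean P n a y⟫_ℂ) κ
        (𝓝 ⟪x, harmonicProjection κ P a y⟫_ℂ) := by
  obtain ⟨S, hS, hlim⟩ := exists_tendsto_inner_of_bounded κ (fun n => cesaroMean P n a)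
    (fun n => hP.norm_cesaroMean_le n a)
  have : harmonicProjection κ P a = S := by
    have h : Tendsto (fun n : ℕ => ContinuousLinearMapWOT.ofCLM (cesaroMean P n a)) κ
        (𝓝 (ContinuousLinearMapWOT.ofCLM S)) :=
      ContinuousLinearMapWOT.tendsto_iff_forall_inner_apply_tendsto.2 fun x y => hlim y x
    exact congrArg ContinuousLinearMapWOT.toCLM h.limUnder_eq
  rw [this]
  exact ⟨hS, hlim⟩

theorem norm_harmonicProjection_le (hP : IsKrausMarkov L ω P) (κ : Ultrafilter ℕ)
    (a : K →L[ℂ] K) : ‖harmonicProjection κ P a‖ ≤ ‖a‖ :=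
  (hP.harmonicProjection_spec κ a).1

theorem tendsto_cesaroMean (hP : IsKrausMarkov L ω P) (κ : Ultrafilter ℕ) (a : K →L[ℂ] K)
    (x y : K) : Tendsto (fun n => ⟪x, cesaroMean P n a y⟫_ℂ) κ
        (𝓝 ⟪x, harmonicProjection κ P a y⟫_ℂ) :=
  (hP.harmonicProjection_spec κ a).2 x y

theorem harmonicProjection_add (hP : IsKrausMarkov L ω P) (κ : Ultrafilter ℕ)
    (a b : K →L[ℂ] K) :
    harmonicProjection κ P (a + b) = harmonicProjection κ P a + harmonicProjection κ P b := by
  refine clm_ext_inner fun x y => tendsto_nhds_unique (hP.tendsto_cesaroMean κ _ x y) ?_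
  have := (hP.tendsto_cesaroMean κ a x y).add (hP.tendsto_cesaroMean κ b x y)
  simpa only [cesaroMean, map_add, Finset.sum_add_distrib, smul_add, inner_add_right,
    add_apply] using this

theorem harmonicProjection_smul (hP : IsKrausMarkov L ω P) (κ : Ultrafilter ℕ) (c : ℂ)
    (a : K →L[ℂ] K) : harmonicProjection κ P (c • a) = c • harmonicProjection κ P a := by
  refine clm_ext_inner fun x y => tendsto_nhds_unique (hP.tendsto_cesaroMean κ _ x y) ?_
  have := (hP.tendsto_cesaroMean κ a x y).const_mul c
  have h : ∀ n, cesaroMean P n (c • a) = c • cesaroMean P n a := fun n => by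
    simp only [cesaroMean, map_smul, ← Finset.smul_sum]
    rw [smul_comm]
  simpa only [h, inner_smul_right, smul_apply] using this

theorem harmonicProjection_sub (hP : IsKrausMarkov L ω P) (κ : Ultrafilter ℕ)
    (a b : K →L[ℂ] K) :
    harmonicProjection κ P (a - b) = harmonicProjection κ P a - harmonicProjection κ P b := by
  rw [sub_eq_add_neg, ← neg_one_smul ℂ b, hP.harmonicProjection_add, hP.harmonicProjection_smul,
    neg_one_smul, ← sub_eq_add_neg]

theorem harmonicProjection_star (hP : IsKrausMarkov L ω P) (κ : Ultrafilter ℕ)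
    (a : K →L[ℂ] K) : harmonicProjection κ P (star a) = star (harmonicProjection κ P a) := by
  refine clm_ext_inner fun x y => tendsto_nhds_unique (hP.tendsto_cesaroMean κ _ x y) ?_
  have h : ∀ n, cesaroMean P n (star a) = star (cesaroMean P n a) := fun n => by
    simp [cesaroMean, hP.pow_map_star]
  have := (Complex.continuous_conj.tendsto _).comp (hP.tendsto_cesaroMean κ a y x)
  simp only [h]
  simpa only [Function.comp_def, inner_conj_symm, ContinuousLinearMap.star_eq_adjoint,
    ContinuousLinearMap.adjoint_inner_right] using this

/-- Squared norms do not pass to weak limits, so the inequality for P^k is linearised first: 2 Re⟪y,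
v⟫ - ‖y‖² ≤ ‖v‖², with y = E(a) x fixed. The linear version averages over k and passes to the limit.
-/
theorem norm_sq_harmonicProjection_le (hP : IsKrausMarkov L ω P) (κ : Ultrafilter ℕ)
    (a : K →L[ℂ] K) (x : K) :
    ‖harmonicProjection κ P a x‖ ^ 2 ≤ (⟪x, harmonicProjection κ P (star a * a) x⟫_ℂ).re := by
  set y := harmonicProjection κ P a x with hy
  have h1 := (Complex.continuous_re.tendsto _).comp (hP.tendsto_cesaroMean κ a y x)
  have h2 := (Complex.continuous_re.tendsto _).comp (hP.tendsto_cesaroMean κ (star a * a) x x)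
  have h3 := (h1.const_mul 2).sub_const (‖y‖ ^ 2)
  have h4 : (⟪y, y⟫_ℂ).re = ‖y‖ ^ 2 := inner_self_eq_norm_sq (𝕜 := ℂ) y
  rw [← hy, h4, two_mul, add_sub_cancel_right] at h3
  refine le_of_tendsto_of_tendsto' h3 h2 fun n => ?_
  have key : ∀ k, 2 * (⟪y, (P ^ k) a x⟫_ℂ).re - ‖y‖ ^ 2 ≤
      (⟪x, (P ^ k) (star a * a) x⟫_ℂ).re := fun k => by
    refine le_trans ?_ (hP.pow_norm_sq_le k a x)
    have h5 := Complex.re_le_norm ⟪y, (P ^ k) a x⟫_ℂ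
    have h6 := norm_inner_le_norm (𝕜 := ℂ) y ((P ^ k) a x)
    nlinarith [sq_nonneg (‖y‖ - ‖(P ^ k) a x‖)]
  simp only [Function.comp_apply, cesaroMean]
  rcases n.eq_zero_or_pos with rfl | hn
  -- The mean at n = 0 is zero since 0⁻¹ = 0; the claim is then -‖y‖² ≤ 0.
  · simp only [CharP.cast_eq_zero, inv_zero, zero_smul, zero_apply,
      inner_zero_right, Complex.zero_re]
    nlinarith [sq_nonneg ‖y‖]
  · have hn' : (0 : ℝ) < n := by exact_mod_cast hn
    have e : ∀ (b : K →L[ℂ] K) (z : K), (⟪z, ((n : ℂ)⁻¹ • ∑ k ∈ Finset.range n, (P ^ k) b) x⟫_ℂ).re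
        = (n : ℝ)⁻¹ * ∑ k ∈ Finset.range n, (⟪z, (P ^ k) b x⟫_ℂ).re := fun b z => by
      rw [smul_apply, inner_smul_right, sum_apply,
        inner_sum, ← Complex.ofReal_natCast, ← Complex.ofReal_inv, Complex.re_ofReal_mul,
        Complex.re_sum]
    rw [e, e, ← sub_nonneg]
    have h7 := Finset.sum_le_sum fun k (_ : k ∈ Finset.range n) => key k
    rw [Finset.sum_sub_distrib, ← Finset.mul_sum, Finset.sum_const, Finset.card_range,
      nsmul_eq_mul] at h7
    have h8 := mul_le_mul_of_nonneg_left h7 (inv_nonneg.2 hn'.le)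
    rw [mul_sub, inv_mul_cancel_left₀ hn'.ne'] at h8
    linarith

theorem map_cesaroMean_sub (n : ℕ) (a : K →L[ℂ] K) :
    P (cesaroMean P n a) - cesaroMean P n a = (n : ℂ)⁻¹ • ((P ^ n) a - a) := by
  rw [cesaroMean, map_smul, map_sum, ← smul_sub, ← Finset.sum_sub_distrib]
  congr 1
  simp only [← pow_succ_apply]
  exact Finset.sum_range_sub (fun k => (P ^ k) a) n

/-- After telescoping, the difference has norm at most 2‖a‖/n, which tends to 0 along κ because κ is
free. -/
theorem tendsto_map_cesaroMean_sub (hP : IsKrausMarkov L ω P) {κ : Ultrafilter ℕ}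
    (hκ : (κ : Filter ℕ) ≤ cofinite) (a : K →L[ℂ] K) :
    Tendsto (fun n => P (cesaroMean P n a) - cesaroMean P n a) κ (𝓝 0) := by
  rw [Nat.cofinite_eq_atTop] at hκ
  refine Tendsto.mono_left ?_ hκ
  refine squeeze_zero_norm (a := fun n : ℕ => (n : ℝ)⁻¹ * (2 * ‖a‖)) (fun n => ?_) ?_
  · rw [map_cesaroMean_sub, norm_smul, norm_inv, Complex.norm_natCast]
    refine mul_le_mul_of_nonneg_left ?_ (by positivity)
    refine (norm_sub_le _ _).trans ?_
    linarith [hP.pow_norm_map_le n a]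
  · simpa using (tendsto_inv_atTop_nhds_zero_nat (𝕜 := ℝ)).mul_const (2 * ‖a‖)

theorem tendsto_inner_map_cesaroMean (hP : IsKrausMarkov L ω P) {κ : Ultrafilter ℕ}
    (hκ : (κ : Filter ℕ) ≤ cofinite) (a : K →L[ℂ] K) (x y : K) :
    Tendsto (fun n => ⟪x, P (cesaroMean P n a) y⟫_ℂ) κ
      (𝓝 ⟪x, harmonicProjection κ P a y⟫_ℂ) := by
  have h1 := (((innerSL ℂ x).continuous.comp
    (ContinuousLinearMap.apply ℂ K y).continuous).tendsto _).comp
    (hP.tendsto_map_cesaroMean_sub hκ a)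
  have h2 := (hP.tendsto_cesaroMean κ a x y).add h1
  refine (h2.congr fun n => ?_).trans (by simp)
  simp [inner_sub_right]

theorem harmonicProjection_map (hP : IsKrausMarkov L ω P) {κ : Ultrafilter ℕ}
    (hκ : (κ : Filter ℕ) ≤ cofinite) (a : K →L[ℂ] K) :
    harmonicProjection κ P (P a) = harmonicProjection κ P a := by
  refine clm_ext_inner fun x y => tendsto_nhds_unique (hP.tendsto_cesaroMean κ _ x y) ?_
  have h : ∀ n, cesaroMean P n (P a) = P (cesaroMean P n a) := fun n => by
    simp only [cesaroMean, map_smul, map_sum, ← pow_succ_apply]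
    simp only [pow_succ]; rfl
  simpa only [h] using hP.tendsto_inner_map_cesaroMean hκ a x y

/-- P commutes with this weak limit: the terms of the series are dominated by ω i ‖a‖‖x‖‖y‖,
uniformly in n, so sum and limit may be interchanged. -/
theorem harmonicProjection_mem (hP : IsKrausMarkov L ω P) {κ : Ultrafilter ℕ}
    (hκ : (κ : Filter ℕ) ≤ cofinite) (a : K →L[ℂ] K) :
    harmonicProjection κ P a ∈ poissonBoundary P := by
  refine clm_ext_inner fun x y => tendsto_nhds_unique ?_ (hP.tendsto_inner_map_cesaroMean hκ a x y)
  simp only [← (hP.hasSum_inner _ x y).tsum_eq]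
  refine tendsto_tsum_of_dominated_convergence (bound := fun i => ω i * (‖a‖ * ‖x‖ * ‖y‖))
    (hP.hasSum_one.summable.mul_right _) (fun i => ?_) (Eventually.of_forall fun n i => ?_)
  · exact (hP.tendsto_cesaroMean κ a _ _).const_mul _
  · rw [norm_mul, Complex.norm_real, Real.norm_of_nonneg (hP.nonneg i)]
    refine mul_le_mul_of_nonneg_left ?_ (hP.nonneg i)
    refine (norm_inner_apply_le _ _ _).trans ?_
    rw [hP.norm_isometry, hP.norm_isometry]
    gcongr
    exact hP.norm_cesaroMean_le n a

theorem harmonicProjection_of_mem (hP : IsKrausMarkov L ω P) {κ : Ultrafilter ℕ}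
    (hκ : (κ : Filter ℕ) ≤ cofinite) {a : K →L[ℂ] K} (ha : a ∈ poissonBoundary P) :
    harmonicProjection κ P a = a := by
  rw [Nat.cofinite_eq_atTop] at hκ
  refine clm_ext_inner fun x y => tendsto_nhds_unique (hP.tendsto_cesaroMean κ _ x y) ?_
  refine tendsto_const_nhds.congr' ?_
  filter_upwards [hκ (eventually_gt_atTop 0)] with n hn
  have h : ∀ k, (P ^ k) a = a := fun k => by
    induction k with
    | zero => rfl
    | succ k ih => rw [pow_succ_apply, ih]; exact ha
  have hn' : (n : ℂ) ≠ 0 := by exact_mod_cast (ne_of_gt hn)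
  simp [cesaroMean, h, ← Nat.cast_smul_eq_nsmul ℂ, smul_smul, hn']

/-- This makes Choi–Effros products computable: no limit is needed when one application of P already
lands in the harmonic elements. -/
theorem harmonicProjection_eq_of_map_mem (hP : IsKrausMarkov L ω P) {κ : Ultrafilter ℕ}
    (hκ : (κ : Filter ℕ) ≤ cofinite) {a : K →L[ℂ] K} (ha : P a ∈ poissonBoundary P) :
    harmonicProjection κ P a = P a := by
  rw [← hP.harmonicProjection_map hκ, hP.harmonicProjection_of_mem hκ ha]

theorem re_inner_harmonicProjection_nonneg (hP : IsKrausMarkov L ω P) (κ : Ultrafilter ℕ)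
    {a : K →L[ℂ] K} (ha : ∀ x, 0 ≤ (⟪x, a x⟫_ℂ).re) (x : K) :
    0 ≤ (⟪x, harmonicProjection κ P a x⟫_ℂ).re := by
  have h := (Complex.continuous_re.tendsto _).comp (hP.tendsto_cesaroMean κ a x x)
  refine ge_of_tendsto' h fun n => ?_
  have hk : ∀ k y, 0 ≤ (⟪y, (P ^ k) a y⟫_ℂ).re := fun k => by
    induction k with
    | zero => exact ha
    | succ k ih =>
      rw [pow_succ_apply]
      exact hP.re_inner_nonneg ih
  rw [Function.comp_apply, cesaroMean, smul_apply, inner_smul_right,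
    sum_apply, inner_sum, ← Complex.ofReal_natCast, ← Complex.ofReal_inv,
    Complex.re_ofReal_mul, Complex.re_sum]
  exact mul_nonneg (by positivity) (Finset.sum_nonneg fun k _ => hk k x)

/-- The form `(a, b) ↦ E(a* b) - E(E(a)* E(b))` is positive semidefinite. -/
theorem re_inner_harmonicProjection_defect_nonneg (hP : IsKrausMarkov L ω P) (κ : Ultrafilter ℕ)
    (a : K →L[ℂ] K) (x : K) :
    (⟪x, harmonicProjection κ P
      (star (harmonicProjection κ P a) * harmonicProjection κ P a) x⟫_ℂ).re ≤
    (⟪x, harmonicProjection κ P (harmonicProjection κ P (star a * a)) x⟫_ℂ).re := by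
  have := hP.re_inner_harmonicProjection_nonneg κ
    (a := harmonicProjection κ P (star a * a) -
      star (harmonicProjection κ P a) * harmonicProjection κ P a) (fun y => ?_) x
  · rw [hP.harmonicProjection_sub, sub_apply, inner_sub_right,
      Complex.sub_re] at this
    linarith
  · rw [sub_apply, inner_sub_right, Complex.sub_re, inner_star_mul_self]
    have h2 : (⟪harmonicProjection κ P a y, harmonicProjection κ P a y⟫_ℂ).re =
      ‖harmonicProjection κ P a y‖ ^ 2 := inner_self_eq_norm_sq (𝕜 := ℂ) _
    linarith [hP.norm_sq_harmonicProjection_le κ a y]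

/-- For harmonic `h`, `E(h* b) = E(h* E(b))`. -/
theorem harmonicProjection_star_mul (hP : IsKrausMarkov L ω P) {κ : Ultrafilter ℕ}
    (hκ : (κ : Filter ℕ) ≤ cofinite) {h : K →L[ℂ] K} (hh : h ∈ poissonBoundary P)
    (b : K →L[ℂ] K) :
    harmonicProjection κ P (star h * harmonicProjection κ P b) =
      harmonicProjection κ P (star h * b) := by
  set E := harmonicProjection κ P with hE
  have hEE : ∀ a, E (E a) = E a := fun a =>
    hP.harmonicProjection_of_mem hκ (hP.harmonicProjection_mem hκ a)
  have hadd : ∀ a b, E (a + b) = E a + E b := hP.harmonicProjection_add κ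
  have hsmul : ∀ (c : ℂ) a, E (c • a) = c • E a := hP.harmonicProjection_smul κ
  have hEh : E h = h := hP.harmonicProjection_of_mem hκ hh
  refine clm_ext_inner_self fun x => ?_
  set z : ℂ := ⟪x, E (star h * b) x⟫_ℂ - ⟪x, E (star h * E b) x⟫_ℂ with hz
  have hz' : starRingEnd ℂ z = ⟪x, E (star b * h) x⟫_ℂ - ⟪x, E (star (E b) * h) x⟫_ℂ := by
    have e : ∀ c, starRingEnd ℂ ⟪x, E (star h * c) x⟫_ℂ = ⟪x, E (star c * h) x⟫_ℂ := fun c => by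
      rw [inner_conj_symm, ← ContinuousLinearMap.adjoint_inner_right,
        ← ContinuousLinearMap.star_eq_adjoint, ← hP.harmonicProjection_star, star_mul, star_star]
    rw [hz, map_sub, e, e]
  -- Positivity of the defect form at b + t h. Since E(h) = h, the |t|² terms cancel, leaving a
  -- real-affine function of t that is never negative; hence its linear coefficient z vanishes.
  have key : ∀ t : ℂ, 0 ≤ (⟪x, E (star b * b) x⟫_ℂ).re - (⟪x, E (star (E b) * E b) x⟫_ℂ).re +
      2 * (starRingEnd ℂ t * z).re := by
    intro t
    have h1 := hP.re_inner_harmonicProjection_defect_nonneg κ (b + t • h) x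
    rw [← hE, hEE, hadd, hsmul, hEh] at h1
    have ex : ∀ c, E (star (c + t • h) * (c + t • h)) = E (star c * c) +
        starRingEnd ℂ t • E (star h * c) + t • E (star c * h) +
        (starRingEnd ℂ t * t) • E (star h * h) := fun c => by
      have : star (c + t • h) * (c + t • h) = star c * c + starRingEnd ℂ t • (star h * c) +
          t • (star c * h) + (starRingEnd ℂ t * t) • (star h * h) := by
        rw [star_add, star_smul, add_mul, mul_add, mul_add, smul_mul_assoc, smul_mul_assoc,
          mul_smul_comm, mul_smul_comm, smul_smul]
        simp only [RCLike.star_def]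
        abel
      rw [this, hadd, hadd, hadd, hsmul, hsmul, hsmul]
    rw [ex, ex] at h1
    simp only [add_apply, smul_apply, inner_add_right,
      inner_smul_right, Complex.add_re] at h1
    have h2 : (t * starRingEnd ℂ z).re = (starRingEnd ℂ t * z).re := by
      simp [Complex.mul_re]
    have h3 : (starRingEnd ℂ t * z).re = (starRingEnd ℂ t * ⟪x, E (star h * b) x⟫_ℂ).re -
        (starRingEnd ℂ t * ⟪x, E (star h * E b) x⟫_ℂ).re := by
      rw [hz, mul_sub, Complex.sub_re]
    have h4 : (t * starRingEnd ℂ z).re = (t * ⟪x, E (star b * h) x⟫_ℂ).re -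
        (t * ⟪x, E (star (E b) * h) x⟫_ℂ).re := by
      rw [hz', mul_sub, Complex.sub_re]
    linarith
  suffices z = 0 by rw [hz, sub_eq_zero] at this; exact this.symm
  by_contra hne
  have hpos : 0 < Complex.normSq z := Complex.normSq_pos.2 hne
  set q := (⟪x, E (star b * b) x⟫_ℂ).re - (⟪x, E (star (E b) * E b) x⟫_ℂ).re
  -- This t makes the linear term equal to -(q + 1), so the whole expression would be -1.
  have h5 := key (((-(q + 1) / (2 * Complex.normSq z) : ℝ) : ℂ) * z)
  have h6 : (starRingEnd ℂ (((-(q + 1) / (2 * Complex.normSq z) : ℝ) : ℂ) * z) * z).re =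
      -(q + 1) / 2 := by
    rw [map_mul, Complex.conj_ofReal, mul_assoc, ← Complex.normSq_eq_conj_mul_self,
      ← Complex.ofReal_mul, Complex.ofReal_re]
    field_simp
  rw [h6] at h5
  linarith

theorem star_mem (hP : IsKrausMarkov L ω P) {a : K →L[ℂ] K} (ha : a ∈ poissonBoundary P) :
    star a ∈ poissonBoundary P := by
  rw [mem_poissonBoundary] at *
  rw [hP.map_star, ha]

theorem harmonicProjection_mul_left (hP : IsKrausMarkov L ω P) {κ : Ultrafilter ℕ}
    (hκ : (κ : Filter ℕ) ≤ cofinite) {h : K →L[ℂ] K} (hh : h ∈ poissonBoundary P)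
    (b : K →L[ℂ] K) :
    harmonicProjection κ P (h * harmonicProjection κ P b) = harmonicProjection κ P (h * b) := by
  simpa using hP.harmonicProjection_star_mul hκ (hP.star_mem hh) b

theorem harmonicProjection_mul_right (hP : IsKrausMarkov L ω P) {κ : Ultrafilter ℕ}
    (hκ : (κ : Filter ℕ) ≤ cofinite) {h : K →L[ℂ] K} (hh : h ∈ poissonBoundary P)
    (b : K →L[ℂ] K) :
    harmonicProjection κ P (harmonicProjection κ P b * h) = harmonicProjection κ P (b * h) := by
  have := congrArg star (hP.harmonicProjection_star_mul hκ hh (star b))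
  rw [hP.harmonicProjection_star κ b] at this
  simpa only [← hP.harmonicProjection_star, star_mul, star_star] using this

end IsKrausMarkov

/-! ### The predual -/

section Predual

/-- If `X` is a space of functionals on `V` that norms `V`, and each bounded functional on the dual
of `V` agrees on `X` with an evaluation, then `V` is the dual of `X`. -/
theorem nonempty_linearIsometryEquiv_dual {V X : Type u} [NormedAddCommGroup V] [NormedSpace ℂ V]
    [NormedAddCommGroup X] [NormedSpace ℂ X] (ι : X →ₗᵢ[ℂ] StrongDual ℂ V)
    (norming : ∀ (x : V) (C : ℝ), 0 ≤ C → (∀ f, ‖ι f x‖ ≤ C * ‖f‖) → ‖x‖ ≤ C)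
    (eval : ∀ F : StrongDual ℂ (StrongDual ℂ V), ∃ x : V, ∀ f, F (ι f) = ι f x) :
    Nonempty (V ≃ₗᵢ[ℂ] StrongDual ℂ X) := by
  let j : V →ₗ[ℂ] StrongDual ℂ X :=
    { toFun := fun x => ContinuousLinearMap.apply ℂ ℂ x ∘L ι.toContinuousLinearMap
      map_add' := fun x y => by ext f; exact map_add (ι f) x y
      map_smul' := fun c x => by ext f; exact map_smul (ι f) c x }
  have hj : ∀ x f, j x f = ι f x := fun _ _ => rfl
  have hnorm : ∀ x, ‖j x‖ = ‖x‖ := by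
    intro x
    apply le_antisymm
    · refine ContinuousLinearMap.opNorm_le_bound _ (norm_nonneg _) fun f => ?_
      rw [mul_comm, ← ι.norm_map]
      exact (ι f).le_opNorm x
    · exact norming x _ (norm_nonneg _) fun f => (j x).le_opNorm f
  have hsurj : Function.Surjective j := by
    intro F
    let e := ι.equivRange
    -- F is transported to the range of ι and extended by Hahn–Banach to the whole dual of V, where
    -- `eval` applies.
    obtain ⟨F', hF', -⟩ := exists_extension_norm_eq (LinearMap.range ι.toLinearMap)
      (F ∘L (e.symm.toContinuousLinearEquiv : _ →L[ℂ] X))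
    obtain ⟨x, hx⟩ := eval F'
    refine ⟨x, ContinuousLinearMap.ext fun f => ?_⟩
    rw [hj, ← hx f]
    refine (hF' (e f)).trans ?_
    exact congrArg F (e.symm_apply_apply f)
  exact ⟨LinearIsometryEquiv.ofSurjective ⟨j, hnorm⟩ hsurj⟩

/-- A Banach space is a dual space if it is normed by a set `s` of functionals such that each
bounded functional on its dual agrees on `s` with an evaluation. -/
theorem exists_predual_of_norming {V : Type u} [NormedAddCommGroup V] [NormedSpace ℂ V]
    (s : Set (StrongDual ℂ V))
    (norming : ∀ (x : V) (C : ℝ), 0 ≤ C → (∀ f ∈ s, ‖f x‖ ≤ C * ‖f‖) → ‖x‖ ≤ C)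
    (eval : ∀ F : StrongDual ℂ (StrongDual ℂ V), ∃ x : V, ∀ f ∈ s, F f = f x) :
    ∃ (X : Type u) (_ : NormedAddCommGroup X) (_ : NormedSpace ℂ X) (_ : CompleteSpace X),
      Nonempty (V ≃ₗᵢ[ℂ] StrongDual ℂ X) := by
  let X := (Submodule.span ℂ s).topologicalClosure
  have hX : ∀ f ∈ s, f ∈ X := fun f hf =>
    Submodule.le_topologicalClosure _ (Submodule.subset_span hf)
  have hcl : IsClosed (X : Set (StrongDual ℂ V)) := Submodule.isClosed_topologicalClosure _
  refine ⟨X, inferInstance, inferInstance, hcl.completeSpace_coe,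
    nonempty_linearIsometryEquiv_dual X.subtypeₗᵢ
      (fun x C hC h => norming x C hC fun f hf => h ⟨f, hX f hf⟩) fun F => ?_⟩
  obtain ⟨x, hx⟩ := eval F
  let G : StrongDual ℂ (StrongDual ℂ V) := F - ContinuousLinearMap.apply ℂ ℂ x
  have hle : X ≤ G.ker := by
    refine Submodule.topologicalClosure_minimal _ (Submodule.span_le.2 fun g hg => ?_)
      G.isClosed_ker
    exact sub_eq_zero.2 (hx g hg)
  exact ⟨x, fun f => sub_eq_zero.1 (hle f.2)⟩

variable {K : Type u} [NormedAddCommGroup K] [InnerProductSpace ℂ K]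
  {V : Type u} [NormedAddCommGroup V] [NormedSpace ℂ V] (val : V →ₗᵢ[ℂ] (K →L[ℂ] K))

/-- The functional `x ↦ ⟪ξ, x η⟫` on a space of operators. -/
def vectorFunctional (ξ η : K) : StrongDual ℂ V :=
  innerSL ℂ ξ ∘L ContinuousLinearMap.apply ℂ K η ∘L val.toContinuousLinearMap

theorem vectorFunctional_apply (ξ η : K) (x : V) :
    vectorFunctional val ξ η x = ⟪ξ, val x η⟫_ℂ := rfl

theorem norm_vectorFunctional_le (ξ η : K) : ‖vectorFunctional val ξ η‖ ≤ ‖ξ‖ * ‖η‖ :=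
  ContinuousLinearMap.opNorm_le_bound _ (by positivity) fun x => by
    refine (norm_inner_apply_le (val x) ξ η).trans_eq ?_
    rw [val.norm_map]
    ring

theorem norm_le_of_vectorFunctional_le (x : V) {C : ℝ} (hC : 0 ≤ C)
    (h : ∀ ξ η, ‖vectorFunctional val ξ η x‖ ≤ C * ‖vectorFunctional val ξ η‖) : ‖x‖ ≤ C := by
  rw [← val.norm_map]
  refine ContinuousLinearMap.opNorm_le_bound _ hC fun η => ?_
  -- Testing against ξ = x η recovers ‖x η‖².
  set ξ := val x η with hξ
  rcases eq_or_ne ξ 0 with h0 | h0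
  · rw [h0, norm_zero]; positivity
  · refine le_of_mul_le_mul_left ?_ (norm_pos_iff.2 h0)
    have h1 := h ξ η
    rw [vectorFunctional_apply, ← hξ, inner_self_eq_norm_sq_to_K] at h1
    have h3 : ‖((‖ξ‖ : ℂ)) ^ 2‖ = ‖ξ‖ * ‖ξ‖ := by simp [sq]
    calc ‖ξ‖ * ‖ξ‖ = _ := h3.symm
      _ ≤ _ := h1
      _ ≤ C * (‖ξ‖ * ‖η‖) := mul_le_mul_of_nonneg_left (norm_vectorFunctional_le val ξ η) hC
      _ = _ := by ring

variable [CompleteSpace K] {ι : Type*} {L : ι → K →L[ℂ] K} {ω : ι → ℝ}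
  {P : (K →L[ℂ] K) →L[ℂ] (K →L[ℂ] K)}

/-- Harmonicity carried over to the functionals. The series converges in the norm of the dual, so an
arbitrary bounded functional on the dual may be applied term by term. -/
theorem hasSum_vectorFunctional (hP : IsKrausMarkov L ω P)
    (hval : ∀ a, a ∈ poissonBoundary P ↔ ∃ x, val x = a) (ξ η : K) :
    HasSum (fun i => (ω i : ℂ) • vectorFunctional val (L i ξ) (L i η))
      (vectorFunctional val ξ η) := by
  have hs : Summable (fun i => (ω i : ℂ) • vectorFunctional val (L i ξ) (L i η)) := by
    refine Summable.of_norm_bounded (hP.hasSum_one.summable.mul_right (‖ξ‖ * ‖η‖)) fun i => ?_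
    rw [norm_smul, Complex.norm_real, Real.norm_of_nonneg (hP.nonneg i)]
    refine mul_le_mul_of_nonneg_left ?_ (hP.nonneg i)
    refine (norm_vectorFunctional_le val (L i ξ) (L i η)).trans ?_
    rw [hP.norm_isometry, hP.norm_isometry]
  convert hs.hasSum
  refine ContinuousLinearMap.ext fun x => ?_
  have h1 := hs.hasSum.mapL (ContinuousLinearMap.apply ℂ ℂ x)
  have h2 := hP.hasSum_inner (val x) ξ η
  rw [mem_poissonBoundary.1 ((hval _).2 ⟨x, rfl⟩)] at h2
  exact h2.unique h1

/-- The space of harmonic elements is a dual Banach space. -/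
theorem exists_predual_poissonBoundary (hP : IsKrausMarkov L ω P)
    (hval : ∀ a, a ∈ poissonBoundary P ↔ ∃ x, val x = a) :
    ∃ (X : Type u) (_ : NormedAddCommGroup X) (_ : NormedSpace ℂ X) (_ : CompleteSpace X),
      Nonempty (V ≃ₗᵢ[ℂ] StrongDual ℂ X) := by
  refine exists_predual_of_norming (Set.range fun p : K × K => vectorFunctional val p.1 p.2)
    (fun x C hC h => norm_le_of_vectorFunctional_le val x hC fun ξ η => h _ ⟨(ξ, η), rfl⟩)
    fun F => ?_
  obtain ⟨T, -, hT⟩ := exists_clm_of_sesquilinear (fun ξ η => F (vectorFunctional val ξ η))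
    (norm_nonneg F)
    (fun x x' y => by
      rw [← map_add]; congr 1; ext a
      simp only [vectorFunctional_apply, inner_add_left, add_apply])
    (fun c x y => by
      rw [← smul_eq_mul, ← map_smul]; congr 1; ext a
      simp only [vectorFunctional_apply, inner_smul_left, smul_apply, smul_eq_mul])
    (fun x y y' => by
      rw [← map_add]; congr 1; ext a
      simp only [vectorFunctional_apply, inner_add_right, add_apply, map_add])
    (fun c x y => by
      rw [← smul_eq_mul, ← map_smul]; congr 1; ext a
      simp only [vectorFunctional_apply, inner_smul_right, smul_apply, map_smul, smul_eq_mul])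
    (fun x y => by
      rw [mul_assoc]
      exact (F.le_opNorm _).trans (mul_le_mul_of_nonneg_left
        (norm_vectorFunctional_le val x y) (norm_nonneg F)))
  -- Applying F to the series of vector functionals turns it into the series for the entries of P T.
  have hTmem : T ∈ poissonBoundary P := by
    refine clm_ext_inner fun ξ η => (hP.hasSum_inner T ξ η).unique ?_
    simpa only [hT, map_smul, smul_eq_mul] using (hasSum_vectorFunctional val hP hval ξ η).mapL F
  obtain ⟨x, hx⟩ := (hval T).1 hTmem
  refine ⟨x, ?_⟩
  rintro _ ⟨p, rfl⟩
  rw [vectorFunctional_apply, hx, hT]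

end Predual

/-! ### The Choi–Effros algebra -/

section HarmonicAlgebra

variable {K : Type u} [NormedAddCommGroup K] [InnerProductSpace ℂ K] [CompleteSpace K]
  {ι : Type*} {L : ι → K →L[ℂ] K} {ω : ι → ℝ} {P : (K →L[ℂ] K) →L[ℂ] (K →L[ℂ] K)}
  {κ : Ultrafilter ℕ}

/-- The space of harmonic elements, regarded as an algebra for the Choi–Effros product. -/
def HarmonicAlgebra (_ : IsKrausMarkov L ω P) (_ : (κ : Filter ℕ) ≤ cofinite) : Type u :=
  poissonBoundary P

namespace HarmonicAlgebra

variable {hP : IsKrausMarkov L ω P} {hκ : (κ : Filter ℕ) ≤ cofinite}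

instance : NormedAddCommGroup (HarmonicAlgebra hP hκ) :=
  inferInstanceAs (NormedAddCommGroup (poissonBoundary P))

instance : NormedSpace ℂ (HarmonicAlgebra hP hκ) :=
  inferInstanceAs (NormedSpace ℂ (poissonBoundary P))

instance : CompleteSpace (HarmonicAlgebra hP hκ) := by
  have : IsClosed (poissonBoundary P : Set (K →L[ℂ] K)) :=
    isClosed_eq P.continuous continuous_id
  exact this.completeSpace_coe

variable (hP hκ) in
/-- The identification of the space of harmonic elements with the algebra on it. -/
def equiv : poissonBoundary P ≃ₗᵢ[ℂ] HarmonicAlgebra hP hκ :=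
  LinearIsometryEquiv.refl ℂ (poissonBoundary P)

/-- The operator underlying an element of the algebra of harmonic elements. -/
def val : HarmonicAlgebra hP hκ →ₗᵢ[ℂ] (K →L[ℂ] K) :=
  (poissonBoundary P).subtypeₗᵢ

theorem val_mem (x : HarmonicAlgebra hP hκ) : val x ∈ poissonBoundary P :=
  Subtype.property (p := fun a => a ∈ poissonBoundary P) x

/-- A harmonic operator as an element of the algebra. -/
def mk (a : K →L[ℂ] K) (ha : a ∈ poissonBoundary P) : HarmonicAlgebra hP hκ :=
  ⟨a, ha⟩

theorem ext {x y : HarmonicAlgebra hP hκ} (h : val x = val y) : x = y :=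
  Subtype.ext h

instance : Mul (HarmonicAlgebra hP hκ) :=
  ⟨fun x y => mk (choiEffros κ P (val x) (val y)) (hP.harmonicProjection_mem hκ _)⟩

instance : One (HarmonicAlgebra hP hκ) := ⟨mk 1 hP.map_one⟩

instance : Star (HarmonicAlgebra hP hκ) := ⟨fun x => mk (star (val x)) (hP.star_mem (val_mem x))⟩

theorem val_mul (x y : HarmonicAlgebra hP hκ) :
    val (x * y) = harmonicProjection κ P (val x * val y) := rfl

theorem val_one : val (1 : HarmonicAlgebra hP hκ) = 1 := rfl

theorem val_star (x : HarmonicAlgebra hP hκ) : val (star x) = star (val x) := rfl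

instance : NormedRing (HarmonicAlgebra hP hκ) where
  __ := (inferInstance : NormedAddCommGroup (HarmonicAlgebra hP hκ))
  left_distrib x y z := ext (by
    simp only [val_mul, map_add, mul_add, hP.harmonicProjection_add])
  right_distrib x y z := ext (by
    simp only [val_mul, map_add, add_mul, hP.harmonicProjection_add])
  zero_mul x := ext (by
    rw [val_mul, map_zero, zero_mul]
    exact hP.harmonicProjection_of_mem hκ (zero_mem _))
  mul_zero x := ext (by
    rw [val_mul, map_zero, mul_zero]
    exact hP.harmonicProjection_of_mem hκ (zero_mem _))
  -- Both bracketings collapse to E applied to the operator product of the three.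
  mul_assoc x y z := ext (by
    simp only [val_mul, hP.harmonicProjection_mul_left hκ (val_mem _),
      hP.harmonicProjection_mul_right hκ (val_mem _), mul_assoc])
  one_mul x := ext (by
    rw [val_mul, val_one, one_mul, hP.harmonicProjection_of_mem hκ (val_mem x)])
  mul_one x := ext (by
    rw [val_mul, val_one, mul_one, hP.harmonicProjection_of_mem hκ (val_mem x)])
  norm_mul_le x y := by
    rw [← val.norm_map, ← val.norm_map, ← val.norm_map, val_mul]
    exact (hP.norm_harmonicProjection_le κ _).trans (norm_mul_le _ _)

instance : StarRing (HarmonicAlgebra hP hκ) where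
  star_involutive x := ext (by rw [val_star, val_star, star_star])
  star_mul x y := ext (by
    rw [val_star, val_mul, val_mul, val_star, val_star, ← hP.harmonicProjection_star, star_mul])
  star_add x y := ext (by simp only [val_star, map_add, star_add])

instance : CStarRing (HarmonicAlgebra hP hκ) where
  norm_mul_self_le x := by
    rw [← val.norm_map, ← val.norm_map, val_mul, val_star]
    set a := val x
    set b := harmonicProjection κ P (star a * a)
    have ha : harmonicProjection κ P a = a := hP.harmonicProjection_of_mem hκ (val_mem x)
    -- Kadison–Schwarz for E with E(a) = a: ‖a y‖² ≤ Re⟪y, b y⟫ ≤ ‖b‖‖y‖².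
    have h : ‖a‖ ≤ √‖b‖ := ContinuousLinearMap.opNorm_le_bound _ (Real.sqrt_nonneg _) fun y => by
      have h1 := hP.norm_sq_harmonicProjection_le κ a y
      rw [ha] at h1
      have h2 := (Complex.re_le_norm _).trans (norm_inner_apply_le b y y)
      refine abs_le_of_sq_le_sq' ?_ (by positivity) |>.2
      rw [mul_pow, Real.sq_sqrt (norm_nonneg _)]
      linarith
    calc ‖a‖ * ‖a‖ ≤ √‖b‖ * √‖b‖ := by gcongr
      _ = ‖b‖ := Real.mul_self_sqrt (norm_nonneg _)

instance : NormedAlgebra ℂ (HarmonicAlgebra hP hκ) where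
  __ := Algebra.ofModule (R := ℂ) (A := HarmonicAlgebra hP hκ)
    (fun c x y => ext (by
      simp only [val_mul, map_smul, smul_mul_assoc, hP.harmonicProjection_smul]))
    (fun c x y => ext (by
      simp only [val_mul, map_smul, mul_smul_comm, hP.harmonicProjection_smul]))
  norm_smul_le := norm_smul_le

instance : StarModule ℂ (HarmonicAlgebra hP hκ) where
  star_smul c x := ext (by simp only [val_star, map_smul, star_smul])

instance : CStarAlgebra (HarmonicAlgebra hP hκ) where

theorem wStarAlgebra : WStarAlgebra (HarmonicAlgebra hP hκ) := by
  obtain ⟨X, i1, i2, i3, ⟨f⟩⟩ := exists_predual_poissonBoundary (val (hP := hP) (hκ := hκ)) hP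
    fun a => ⟨fun ha => ⟨mk a ha, rfl⟩, fun ⟨x, hx⟩ => hx ▸ val_mem x⟩
  -- The identification with the dual has to be conjugate-linear here, hence the composition with
  -- the adjoint.
  exact ⟨X, i1, i2, i3, ⟨f.symm.trans (starₗᵢ ℂ)⟩⟩

end HarmonicAlgebra

end HarmonicAlgebra

/-! ### The full Fock space -/

section Fock

variable {H : Type u} [NormedAddCommGroup H] [InnerProductSpace ℂ H]

/-- The embedding of `H^{⊗n}` into the full Fock space. -/
def fockSingle (n : ℕ) : TensorPow H n →L[ℂ] FockSpace H :=
  lp.singleContinuousLinearMap ℂ (fun n : ℕ => TensorPow H n) 2 n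

/-- The `n`-particle component of a vector of the full Fock space. -/
def fockComponent (x : FockSpace H) (n : ℕ) : TensorPow H n :=
  (show lp (fun n : ℕ => TensorPow H n) 2 from x) n

theorem fockComponent_fockSingle_self (n : ℕ) (y : TensorPow H n) :
    fockComponent (fockSingle n y) n = y :=
  lp.single_apply_self (E := fun n : ℕ => TensorPow H n) 2 n y

theorem fockComponent_fockSingle_of_ne {m n : ℕ} (h : m ≠ n) (y : TensorPow H n) :
    fockComponent (fockSingle n y) m = 0 :=
  lp.single_apply_ne (E := fun n : ℕ => TensorPow H n) 2 n y h

variable (H) in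
/-- The unit vector of `H^{⊗0}`. -/
def vacuumUnit : TensorPow H 0 :=
  (EuclideanSpace.single PUnit.unit (1 : ℂ) : EuclideanSpace ℂ PUnit.{u + 1})

theorem norm_vacuumUnit : ‖vacuumUnit H‖ = 1 :=
  (PiLp.norm_single 2 (fun _ : PUnit.{u + 1} => ℂ) PUnit.unit 1).trans norm_one

theorem exists_eq_smul_vacuumUnit (y : TensorPow H 0) : ∃ c : ℂ, y = c • vacuumUnit H := by
  have h : ∀ y : EuclideanSpace ℂ PUnit.{u + 1},
      y = y PUnit.unit • EuclideanSpace.single PUnit.unit (1 : ℂ) := fun y => by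
    ext j
    simp
  exact ⟨_, h y⟩

theorem fock_ext {x y : FockSpace H} (h : ∀ n, fockComponent x n = fockComponent y n) : x = y :=
  lp.ext (funext h)

theorem hasSum_fock_inner (x y : FockSpace H) :
    HasSum (fun n => ⟪fockComponent x n, fockComponent y n⟫_ℂ) ⟪x, y⟫_ℂ :=
  lp.hasSum_inner (𝕜 := ℂ) (G := fun n : ℕ => TensorPow H n) x y

theorem fockComponent_leftCreation_zero (ξ : H) (x : FockSpace H) :
    fockComponent (leftCreation ξ x) 0 = 0 := rfl

theorem fockComponent_leftCreation_succ (ξ : H) (x : FockSpace H) (n : ℕ) :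
    fockComponent (leftCreation ξ x) (n + 1) = leftTensor ξ n (fockComponent x n) := rfl

theorem fockComponent_rightCreation_zero (ξ : H) (x : FockSpace H) :
    fockComponent (rightCreation ξ x) 0 = 0 := rfl

theorem fockComponent_rightCreation_succ (ξ : H) (x : FockSpace H) (n : ℕ) :
    fockComponent (rightCreation ξ x) (n + 1) = rightTensor ξ n (fockComponent x n) := rfl

theorem inner_leftTensor (ξ ζ : H) (n : ℕ) (y z : TensorPow H n) :
    ⟪leftTensor ξ n y, leftTensor ζ n z⟫_ℂ = ⟪ξ, ζ⟫_ℂ * ⟪y, z⟫_ℂ :=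
  (UniformSpace.Completion.inner_coe (ξ ⊗ₜ[ℂ] y) (ζ ⊗ₜ[ℂ] z)).trans (TensorProduct.inner_tmul ℂ ξ ζ y z)

theorem rightTensor_leftTensor (ξ ζ : H) (n : ℕ) (y : TensorPow H n) :
    rightTensor ξ (n + 1) (leftTensor ζ n y) = leftTensor ζ (n + 1) (rightTensor ξ n y) :=
  ContinuousLinearMap.completion_apply_coe ((rightTensor ξ n).lTensor H) _

theorem inner_leftCreation (ξ ζ : H) (x y : FockSpace H) :
    ⟪leftCreation ξ x, leftCreation ζ y⟫_ℂ = ⟪ξ, ζ⟫_ℂ * ⟪x, y⟫_ℂ := by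
  refine (hasSum_fock_inner _ _).unique ?_
  rw [← hasSum_nat_add_iff' 1]
  simpa [fockComponent_leftCreation_zero, fockComponent_leftCreation_succ, inner_leftTensor] using
    (hasSum_fock_inner x y).mul_left ⟪ξ, ζ⟫_ℂ

theorem rightCreation_leftCreation (ξ ζ : H) (x : FockSpace H) :
    rightCreation ξ (leftCreation ζ x) = leftCreation ζ (rightCreation ξ x) := by
  refine fock_ext fun n => ?_
  match n with
  | 0 => rfl
  | 1 =>
    rw [fockComponent_rightCreation_succ, fockComponent_leftCreation_succ,
      fockComponent_leftCreation_zero, fockComponent_rightCreation_zero, map_zero, map_zero]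
  | n + 2 => exact rightTensor_leftTensor ξ ζ n _

theorem fockComponent_vacuum_succ (n : ℕ) : fockComponent (vacuum H) (n + 1) = 0 :=
  fockComponent_fockSingle_of_ne n.succ_ne_zero _

theorem inner_vacuum_leftCreation (ξ : H) (x : FockSpace H) :
    ⟪vacuum H, leftCreation ξ x⟫_ℂ = 0 := by
  refine (hasSum_fock_inner _ _).unique ?_
  convert hasSum_zero with n
  cases n with
  | zero => rw [fockComponent_leftCreation_zero, inner_zero_right]
  | succ n => rw [fockComponent_vacuum_succ, inner_zero_left]

theorem inner_vacuum_rightCreation (ξ : H) (x : FockSpace H) :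
    ⟪vacuum H, rightCreation ξ x⟫_ℂ = 0 := by
  refine (hasSum_fock_inner _ _).unique ?_
  convert hasSum_zero with n
  cases n with
  | zero => rw [fockComponent_rightCreation_zero, inner_zero_right]
  | succ n => rw [fockComponent_vacuum_succ, inner_zero_left]

theorem norm_vacuum : ‖vacuum H‖ = 1 :=
  (lp.norm_single (E := fun n : ℕ => TensorPow H n) (p := 2) (by norm_num) 0
    (vacuumUnit H)).trans norm_vacuumUnit

theorem inner_vacuum_self : ⟪vacuum H, vacuum H⟫_ℂ = 1 := by
  simp [inner_self_eq_norm_sq_to_K, norm_vacuum]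

theorem rightCreation_vacuum (ξ : H) :
    rightCreation ξ (vacuum H) = leftCreation ξ (vacuum H) := by
  refine fock_ext fun n => ?_
  match n with
  | 0 => rfl
  | 1 => rfl
  | n + 2 =>
    rw [fockComponent_rightCreation_succ, fockComponent_leftCreation_succ,
      fockComponent_vacuum_succ, map_zero, map_zero]

theorem leftCreation_fockSingle (ξ : H) (n : ℕ) (y : TensorPow H n) :
    leftCreation ξ (fockSingle n y) = fockSingle (n + 1) (leftTensor ξ n y) := by
  refine fock_ext fun m => ?_
  cases m with
  | zero =>
    rw [fockComponent_leftCreation_zero, fockComponent_fockSingle_of_ne n.succ_ne_zero.symm]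
  | succ m =>
    rw [fockComponent_leftCreation_succ]
    rcases eq_or_ne m n with rfl | h
    · rw [fockComponent_fockSingle_self, fockComponent_fockSingle_self]
    · rw [fockComponent_fockSingle_of_ne h, map_zero,
        fockComponent_fockSingle_of_ne (by omega)]

/-! ### The vectors e_I and their totality. -/

section Basis

variable {Θ : Type*} (e : Θ → H)

theorem simpleBasisVec_cons (i : Θ) (I : List Θ) :
    simpleBasisVec e (i :: I) = leftCreation (e i) (simpleBasisVec e I) := rfl

theorem rightCreation_simpleBasisVec (i : Θ) (I : List Θ) :
    rightCreation (e i) (simpleBasisVec e I) = simpleBasisVec e (I ++ [i]) := by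
  induction I with
  | nil => exact rightCreation_vacuum _
  | cons j I ih => rw [simpleBasisVec_cons, rightCreation_leftCreation, ih]; rfl

theorem inner_simpleBasisVec [DecidableEq Θ] (he : Orthonormal ℂ e) (I J : List Θ) :
    ⟪simpleBasisVec e J, simpleBasisVec e I⟫_ℂ = if J = I then 1 else 0 := by
  induction J generalizing I with
  | nil =>
    cases I with
    | nil => simpa using! inner_vacuum_self (H := H)
    | cons i I => simpa using! inner_vacuum_leftCreation (e i) (simpleBasisVec e I)
  | cons j J ih =>
    cases I with
    | nil =>
      rw [← inner_conj_symm, if_neg (List.cons_ne_nil j J), ← map_zero (starRingEnd ℂ)]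
      exact congrArg _ (inner_vacuum_leftCreation (e j) (simpleBasisVec e J))
    | cons i I =>
      rw [simpleBasisVec_cons, simpleBasisVec_cons, inner_leftCreation, ih,
        orthonormal_iff_ite.1 he]
      by_cases h : j = i <;> simp [h]

/-- The closed span W is stable under l_i, which sends e_I to e_{iI}; so W contains e_i ⊗ y whenever
it contains y. Totality of the e_i gives ξ ⊗ y, then linearity and closedness give the completed
tensor product. -/
theorem fockSingle_mem_closure_span (he : (Submodule.span ℂ (Set.range e)).topologicalClosure = ⊤)
    (n : ℕ) (y : TensorPow H n) :
    fockSingle n y ∈ (Submodule.span ℂ (Set.range (simpleBasisVec e))).topologicalClosure := by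
  set W := (Submodule.span ℂ (Set.range (simpleBasisVec e))).topologicalClosure with hW
  have hWc : IsClosed (W : Set (FockSpace H)) := Submodule.isClosed_topologicalClosure _
  have hmem : ∀ I, simpleBasisVec e I ∈ W := fun I =>
    Submodule.le_topologicalClosure _ (Submodule.subset_span ⟨I, rfl⟩)
  have hleft : ∀ (i : Θ), ∀ x ∈ W, leftCreation (e i) x ∈ W := by
    intro i
    suffices W ≤ W.comap (leftCreation (e i)).toLinearMap from this
    refine Submodule.topologicalClosure_minimal _ (Submodule.span_le.2 ?_)
      (hWc.preimage (leftCreation (e i)).continuous)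
    rintro _ ⟨I, rfl⟩
    exact hmem (i :: I)
  induction n with
  | zero =>
    obtain ⟨c, rfl⟩ := exists_eq_smul_vacuumUnit y
    rw [map_smul]
    exact W.smul_mem c (hmem [])
  | succ n ih =>
    have hsub : ∀ z : H ⊗[ℂ] TensorPow H n,
        fockSingle (n + 1) (z : UniformSpace.Completion (H ⊗[ℂ] TensorPow H n)) ∈ W := by
      intro z
      induction z using TensorProduct.induction_on with
      | zero =>
        rw [UniformSpace.Completion.coe_zero]
        exact ((fockSingle (H := H) (n + 1)).map_zero ▸ W.zero_mem :)
      | add a b ha hb =>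
        rw [UniformSpace.Completion.coe_add]
        exact ((fockSingle (H := H) (n + 1)).map_add
          (a : UniformSpace.Completion (H ⊗[ℂ] TensorPow H n))
          (b : UniformSpace.Completion (H ⊗[ℂ] TensorPow H n)) ▸ W.add_mem ha hb :)
      | tmul ξ y =>
        let f : H →L[ℂ] FockSpace H := fockSingle (n + 1) ∘L
          (UniformSpace.Completion.toComplL : H ⊗[ℂ] TensorPow H n →L[ℂ] _) ∘L
            (TensorProduct.mkL ℂ H (TensorPow H n)).flip y
        suffices h : (Submodule.span ℂ (Set.range e)).topologicalClosure ≤ W.comap f.toLinearMap by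
          exact h (he ▸ Submodule.mem_top : ξ ∈ _)
        refine Submodule.topologicalClosure_minimal _ (Submodule.span_le.2 ?_)
          (hWc.preimage f.continuous)
        rintro _ ⟨i, rfl⟩
        change fockSingle (n + 1) (leftTensor (e i) n y) ∈ W
        rw [← leftCreation_fockSingle]
        exact hleft i _ (ih y)
    induction y using UniformSpace.Completion.induction_on with
    | hp => exact hWc.preimage (fockSingle (n + 1)).continuous
    | ih z => exact hsub z

theorem closure_span_simpleBasisVec
    (he : (Submodule.span ℂ (Set.range e)).topologicalClosure = ⊤) :
    (Submodule.span ℂ (Set.range (simpleBasisVec e))).topologicalClosure = ⊤ := by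
  refine eq_top_iff.2 fun x _ => ?_
  have : HasSum (fun n => fockSingle n (fockComponent x n)) x :=
    lp.hasSum_single (E := fun n : ℕ => TensorPow H n) (by norm_num) x
  exact (Submodule.isClosed_topologicalClosure _).mem_of_tendsto this
    (Eventually.of_forall fun s => Submodule.sum_mem _ fun n _ =>
      fockSingle_mem_closure_span e he n _)

end Basis
end Fock

/-! ### The Markov operator on the full Fock space -/

section FockMarkov

variable {H : Type u} [NormedAddCommGroup H] [InnerProductSpace ℂ H] {Θ : Type*} {e : Θ → H}
  {ω : Θ → ℝ}

theorem star_leftCreation_mul (he : Orthonormal ℂ e) (i : Θ) :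
    star (leftCreation (e i)) * leftCreation (e i) = 1 := by
  refine clm_ext_inner fun x y => ?_
  rw [inner_star_mul_self, inner_leftCreation, inner_self_eq_norm_sq_to_K, he.1 i]
  simp

theorem isKrausMarkov_markovOperator (he : Orthonormal ℂ e) (hω_nonneg : ∀ i, 0 ≤ ω i)
    (hω_sum : HasSum ω 1) :
    IsKrausMarkov (fun i => leftCreation (e i)) ω (markovOperator e ω) where
  nonneg := hω_nonneg
  hasSum_one := hω_sum
  isometry := star_leftCreation_mul he
  hasSum := hasSum_markovOperator e ω he.1 hω_sum.summable hω_nonneg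

variable (H) in
/-- The projection onto the vacuum vector. -/
def vacuumProjection : FockSpace H →L[ℂ] FockSpace H :=
  InnerProductSpace.rankOne ℂ (vacuum H) (vacuum H)

theorem vacuumProjection_apply (x : FockSpace H) :
    vacuumProjection H x = ⟪vacuum H, x⟫_ℂ • vacuum H :=
  InnerProductSpace.rankOne_apply ..

theorem vacuumProjection_mul_leftCreation (ξ : H) : vacuumProjection H * leftCreation ξ = 0 := by
  ext1 x
  change vacuumProjection H (leftCreation ξ x) = 0
  rw [vacuumProjection_apply, inner_vacuum_leftCreation, zero_smul]

theorem star_vacuumProjection : star (vacuumProjection H) = vacuumProjection H := by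
  refine clm_ext_inner fun x y => ?_
  rw [ContinuousLinearMap.star_eq_adjoint, ContinuousLinearMap.adjoint_inner_right,
    vacuumProjection_apply, vacuumProjection_apply, inner_smul_left, inner_smul_right,
    inner_conj_symm, mul_comm]

theorem star_leftCreation_mul_vacuumProjection (ξ : H) :
    star (leftCreation ξ) * vacuumProjection H = 0 := by
  rw [← star_vacuumProjection, ← star_mul, vacuumProjection_mul_leftCreation, star_zero]

theorem fock_ext_inner (htot : (Submodule.span ℂ (Set.range e)).topologicalClosure = ⊤)
    {x y : FockSpace H} (h : ∀ J, ⟪simpleBasisVec e J, x⟫_ℂ = ⟪simpleBasisVec e J, y⟫_ℂ) :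
    x = y := by
  have hd := Submodule.dense_iff_topologicalClosure_eq_top.2 (closure_span_simpleBasisVec e htot)
  have : innerSL ℂ x = innerSL ℂ y := ContinuousLinearMap.ext_on hd (by
    rintro _ ⟨J, rfl⟩
    have := congrArg (starRingEnd ℂ) (h J)
    rwa [inner_conj_symm, inner_conj_symm] at this)
  exact ext_inner_right ℂ fun z => congrArg (fun f => f z) this

theorem fock_clm_ext (htot : (Submodule.span ℂ (Set.range e)).topologicalClosure = ⊤)
    {S T : FockSpace H →L[ℂ] FockSpace H}
    (h : ∀ I, S (simpleBasisVec e I) = T (simpleBasisVec e I)) : S = T :=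
  ContinuousLinearMap.ext_on
    (Submodule.dense_iff_topologicalClosure_eq_top.2 (closure_span_simpleBasisVec e htot))
    (by rintro _ ⟨I, rfl⟩; exact h I)

theorem rightCreation_mul_leftCreation (ξ ζ : H) :
    rightCreation ξ * leftCreation ζ = leftCreation ζ * rightCreation ξ :=
  ContinuousLinearMap.ext fun x => rightCreation_leftCreation ξ ζ x

theorem star_rightCreation_mul (he : Orthonormal ℂ e)
    (htot : (Submodule.span ℂ (Set.range e)).topologicalClosure = ⊤) (i : Θ) :
    star (rightCreation (e i)) * rightCreation (e i) = 1 := by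
  classical
  refine fock_clm_ext htot fun I => fock_ext_inner htot fun J => ?_
  rw [inner_star_mul_self, rightCreation_simpleBasisVec, rightCreation_simpleBasisVec,
    inner_simpleBasisVec e he, one_apply_eq_self, inner_simpleBasisVec e he]
  simp

/-- r_i* removes a final letter i. The last letter of k I is that of I, so removal commutes with
prefixing k unless I is empty; then the letter removed is k itself, which produces the vacuum term.
-/
theorem star_rightCreation_mul_leftCreation [DecidableEq Θ] (he : Orthonormal ℂ e)
    (htot : (Submodule.span ℂ (Set.range e)).topologicalClosure = ⊤) (i k : Θ) :
    star (rightCreation (e i)) * leftCreation (e k) =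
      leftCreation (e k) * star (rightCreation (e i)) +
        if k = i then vacuumProjection H else 0 := by
  refine fock_clm_ext htot fun I => fock_ext_inner htot fun J => ?_
  have hr : ∀ (J : List Θ) (x : FockSpace H),
      ⟪simpleBasisVec e J, star (rightCreation (e i)) x⟫_ℂ = ⟪simpleBasisVec e (J ++ [i]), x⟫_ℂ :=
    fun J x => by
      rw [ContinuousLinearMap.star_eq_adjoint, ContinuousLinearMap.adjoint_inner_right,
        rightCreation_simpleBasisVec]
  have hv : ⟪simpleBasisVec e J, (if k = i then vacuumProjection H else 0)
      (simpleBasisVec e I)⟫_ℂ = if k = i ∧ I = [] ∧ J = [] then 1 else 0 := by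
    have h1 := inner_simpleBasisVec e he I []
    have h2 := inner_simpleBasisVec e he [] J
    split_ifs with h h' h'
    · rw [vacuumProjection_apply, inner_smul_right]
      exact (congrArg₂ (· * ·) h1 h2).trans (by simp [h'])
    · rw [vacuumProjection_apply, inner_smul_right]
      refine (congrArg₂ (· * ·) h1 h2).trans ?_
      by_cases hI : I = []
      · have hJ : J ≠ [] := fun hJ => h' ⟨h, hI, hJ⟩
        simp [hJ]
      · simp [Ne.symm hI]
    · exact absurd h'.1 h
    · rw [zero_apply, inner_zero_right]
  rw [add_apply, inner_add_right, hv]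
  change ⟪simpleBasisVec e J, star (rightCreation (e i)) (simpleBasisVec e (k :: I))⟫_ℂ =
    ⟪simpleBasisVec e J, leftCreation (e k) (star (rightCreation (e i)) (simpleBasisVec e I))⟫_ℂ + _
  rw [hr, inner_simpleBasisVec e he]
  cases J with
  | nil =>
    rw [show ⟪simpleBasisVec e [], leftCreation (e k) _⟫_ℂ = 0 from inner_vacuum_leftCreation _ _]
    simp [eq_comm]
  | cons j J =>
    rw [simpleBasisVec_cons, inner_leftCreation, hr, inner_simpleBasisVec e he,
      orthonormal_iff_ite.1 he]
    by_cases h : j = k <;> simp [h]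

theorem star_leftCreation_mul_rightCreation [DecidableEq Θ] (he : Orthonormal ℂ e)
    (htot : (Submodule.span ℂ (Set.range e)).topologicalClosure = ⊤) (i k : Θ) :
    star (leftCreation (e k)) * rightCreation (e i) =
      rightCreation (e i) * star (leftCreation (e k)) +
        if k = i then vacuumProjection H else 0 := by
  have := congrArg star (star_rightCreation_mul_leftCreation he htot i k)
  rw [star_add, star_mul, star_mul, star_star] at this
  rw [this, apply_ite star, star_vacuumProjection, star_zero]

/-! ### Choi–Effros products with right creation operators. -/

section Markov

variable {P : (FockSpace H →L[ℂ] FockSpace H) →L[ℂ] (FockSpace H →L[ℂ] FockSpace H)}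

theorem map_mul_rightCreation (hP : IsKrausMarkov (fun i => leftCreation (e i)) ω P) (ξ : H)
    (x : FockSpace H →L[ℂ] FockSpace H) : P (x * rightCreation ξ) = P x * rightCreation ξ := by
  refine (hP.hasSum _).unique ?_
  refine ((hP.hasSum x).mul_right (rightCreation ξ)).congr_fun fun i => ?_
  simp only [smul_mul_assoc, mul_assoc, rightCreation_mul_leftCreation]

/-- Moving r_i past l_k* produces a vacuum term only for k = i, so the series contributes a single
correction. -/
theorem map_rightCreation_mul (hP : IsKrausMarkov (fun i => leftCreation (e i)) ω P)
    (he : Orthonormal ℂ e) (htot : (Submodule.span ℂ (Set.range e)).topologicalClosure = ⊤) (i : Θ)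
    (x : FockSpace H →L[ℂ] FockSpace H) :
    P (rightCreation (e i) * x) = rightCreation (e i) * P x +
      (ω i : ℂ) • (vacuumProjection H * x * leftCreation (e i)) := by
  classical
  refine (hP.hasSum _).unique ?_
  have h := ((hP.hasSum x).mul_left (rightCreation (e i))).add
    (hasSum_ite_eq i ((ω i : ℂ) • (vacuumProjection H * x * leftCreation (e i))))
  refine h.congr_fun fun k => ?_
  rw [← mul_assoc, star_leftCreation_mul_rightCreation he htot, add_mul, add_mul, smul_add,
    mul_smul_comm]
  simp only [mul_assoc]
  congr 1
  split_ifs with hk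
  · rw [hk]
  · rw [zero_mul, smul_zero]

theorem map_vacuumProjection_mul (hP : IsKrausMarkov (fun i => leftCreation (e i)) ω P)
    (x : FockSpace H →L[ℂ] FockSpace H) : P (vacuumProjection H * x) = 0 := by
  refine (hP.hasSum _).unique ?_
  convert hasSum_zero with k
  rw [← mul_assoc, star_leftCreation_mul_vacuumProjection, zero_mul, zero_mul, smul_zero]

theorem rightCreation_mem (hP : IsKrausMarkov (fun i => leftCreation (e i)) ω P) (ξ : H) :
    rightCreation ξ ∈ poissonBoundary P := by
  have := map_mul_rightCreation hP ξ 1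
  rwa [hP.map_one, one_mul] at this

variable {κ : Ultrafilter ℕ}

theorem choiEffros_rightCreation_right (hP : IsKrausMarkov (fun i => leftCreation (e i)) ω P)
    (hκ : (κ : Filter ℕ) ≤ cofinite) (ξ : H) {x : FockSpace H →L[ℂ] FockSpace H}
    (hx : x ∈ poissonBoundary P) : choiEffros κ P x (rightCreation ξ) = x * rightCreation ξ := by
  refine hP.harmonicProjection_of_mem hκ ?_
  rw [mem_poissonBoundary, map_mul_rightCreation hP, hx]

theorem choiEffros_rightCreation_left (hP : IsKrausMarkov (fun i => leftCreation (e i)) ω P)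
    (hκ : (κ : Filter ℕ) ≤ cofinite) (he : Orthonormal ℂ e)
    (htot : (Submodule.span ℂ (Set.range e)).topologicalClosure = ⊤) (i : Θ)
    {x : FockSpace H →L[ℂ] FockSpace H} (hx : x ∈ poissonBoundary P) :
    choiEffros κ P (rightCreation (e i)) x = rightCreation (e i) * x +
      (ω i : ℂ) • (vacuumProjection H * x * leftCreation (e i)) := by
  have h : P (rightCreation (e i) * x) = rightCreation (e i) * x +
      (ω i : ℂ) • (vacuumProjection H * x * leftCreation (e i)) := by
    rw [map_rightCreation_mul hP he htot, mem_poissonBoundary.1 hx]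
  rw [← h]
  refine hP.harmonicProjection_eq_of_map_mem hκ ?_
  rw [mem_poissonBoundary]
  -- A second application of P reproduces the same correction and annihilates the old one, so P(r_i
  -- x) is harmonic.
  rw [h, map_add, map_smul, mul_assoc (vacuumProjection H), map_vacuumProjection_mul hP,
    smul_zero, add_zero, h, mul_assoc (vacuumProjection H)]

theorem star_choiEffros (hP : IsKrausMarkov (fun i => leftCreation (e i)) ω P)
    (x y : FockSpace H →L[ℂ] FockSpace H) :
    star (choiEffros κ P x y) = choiEffros κ P (star y) (star x) := by
  rw [choiEffros, choiEffros, ← hP.harmonicProjection_star, star_mul]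

end Markov

/-! ### Central elements are scalar. -/

section Center

variable {x : FockSpace H →L[ℂ] FockSpace H}

theorem apply_simpleBasisVec_append
    (hx : ∀ i, x * rightCreation (e i) = rightCreation (e i) * x +
      (ω i : ℂ) • (vacuumProjection H * x * leftCreation (e i))) (I : List Θ) (i : Θ) :
    x (simpleBasisVec e (I ++ [i])) = rightCreation (e i) (x (simpleBasisVec e I)) +
      ((ω i : ℂ) * ⟪vacuum H, x (simpleBasisVec e (i :: I))⟫_ℂ) • vacuum H := by
  rw [← rightCreation_simpleBasisVec]
  have := congrArg (fun T => T (simpleBasisVec e I)) (hx i)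
  refine this.trans ?_
  rw [mul_smul, simpleBasisVec_cons, ← vacuumProjection_apply]
  rfl

/-- The range of r_i is orthogonal to Ω, so moving a last letter i to the front costs exactly ω i;
the letters of J are moved one at a time. -/
theorem inner_vacuum_apply_append
    (hx : ∀ i, x * rightCreation (e i) = rightCreation (e i) * x +
      (ω i : ℂ) • (vacuumProjection H * x * leftCreation (e i))) (I J : List Θ) :
    ⟪vacuum H, x (simpleBasisVec e (I ++ J))⟫_ℂ =
      ((J.map ω).prod : ℂ) * ⟪vacuum H, x (simpleBasisVec e (J ++ I))⟫_ℂ := by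
  induction J using List.reverseRecOn generalizing I with
  | nil => simp
  | append_singleton J i ih =>
    rw [← List.append_assoc, apply_simpleBasisVec_append hx, inner_add_right,
      inner_vacuum_rightCreation, zero_add, inner_smul_right, inner_vacuum_self, mul_one,
      ← List.cons_append, ih]
    simp only [List.map_append, List.map_cons, List.map_nil, List.prod_append, List.prod_cons,
      List.prod_nil, Complex.ofReal_mul, mul_one, List.append_assoc, List.cons_append,
      List.nil_append]
    ring

theorem list_prod_map_lt_one (hω_pos : ∀ i, 0 < ω i) (hω_lt : ∀ i, ω i < 1) {I : List Θ}
    (hI : I ≠ []) : (I.map ω).prod < 1 := by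
  have hpos : ∀ I : List Θ, 0 < (I.map ω).prod := fun I =>
    List.prod_pos fun a ha => by
      obtain ⟨i, -, rfl⟩ := List.mem_map.1 ha
      exact hω_pos i
  have hle : ∀ I : List Θ, (I.map ω).prod ≤ 1 := fun I => by
    induction I with
    | nil => simp
    | cons i I ih =>
      rw [List.map_cons, List.prod_cons]
      exact mul_le_one₀ (hω_lt i).le (hpos I).le ih
  cases I with
  | nil => exact absurd rfl hI
  | cons i I =>
    rw [List.map_cons, List.prod_cons]
    exact mul_lt_one_of_nonneg_of_lt_one_left (hω_pos i).le (hω_lt i) (hle I)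

theorem inner_vacuum_apply_eq_zero (hω_pos : ∀ i, 0 < ω i) (hω_lt : ∀ i, ω i < 1)
    (hx : ∀ i, x * rightCreation (e i) = rightCreation (e i) * x +
      (ω i : ℂ) • (vacuumProjection H * x * leftCreation (e i))) {I : List Θ} (hI : I ≠ []) :
    ⟪vacuum H, x (simpleBasisVec e I)⟫_ℂ = 0 := by
  -- Rotating the whole word returns it to itself, multiplied by its weight.
  have h := inner_vacuum_apply_append hx [] I
  rw [List.nil_append, List.append_nil] at h
  have h1 : (((I.map ω).prod : ℝ) : ℂ) ≠ 1 := by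
    exact_mod_cast (list_prod_map_lt_one hω_pos hω_lt hI).ne
  have h2 : (1 - (((I.map ω).prod : ℝ) : ℂ)) * ⟪vacuum H, x (simpleBasisVec e I)⟫_ℂ = 0 := by
    rw [sub_mul, one_mul, ← h, sub_self]
  exact (mul_eq_zero.1 h2).resolve_left (sub_ne_zero.2 h1.symm)

theorem eq_smul_one_of_intertwining (he : Orthonormal ℂ e)
    (htot : (Submodule.span ℂ (Set.range e)).topologicalClosure = ⊤)
    (hω_pos : ∀ i, 0 < ω i) (hω_lt : ∀ i, ω i < 1)
    (hx : ∀ i, x * rightCreation (e i) = rightCreation (e i) * x +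
      (ω i : ℂ) • (vacuumProjection H * x * leftCreation (e i)))
    (hx' : ∀ i, star x * rightCreation (e i) = rightCreation (e i) * star x +
      (ω i : ℂ) • (vacuumProjection H * star x * leftCreation (e i))) :
    x = ⟪vacuum H, x (vacuum H)⟫_ℂ • (1 : FockSpace H →L[ℂ] FockSpace H) := by
  classical
  have hvac : x (vacuum H) = ⟪vacuum H, x (vacuum H)⟫_ℂ • vacuum H := by
    refine fock_ext_inner htot fun J => ?_
    rw [inner_smul_right]
    rcases eq_or_ne J [] with rfl | hJ
    · change ⟪vacuum H, x (vacuum H)⟫_ℂ = _ * ⟪vacuum H, vacuum H⟫_ℂ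
      rw [inner_vacuum_self, mul_one]
    -- The relation for x* controls ⟪xΩ, e_J⟫, which the relation for x alone does not address.
    · have h1 := inner_vacuum_apply_eq_zero hω_pos hω_lt hx' hJ
      rw [ContinuousLinearMap.star_eq_adjoint, ContinuousLinearMap.adjoint_inner_right] at h1
      have h2 : ⟪simpleBasisVec e J, vacuum H⟫_ℂ = 0 :=
        (inner_simpleBasisVec e he [] J).trans (if_neg hJ)
      rw [h2, mul_zero, ← inner_conj_symm, h1, map_zero]
  refine fock_clm_ext htot fun I => ?_
  rw [smul_apply, one_apply_eq_self]
  induction I using List.reverseRecOn with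
  | nil => exact hvac
  | append_singleton I i ih =>
    rw [apply_simpleBasisVec_append hx, inner_vacuum_apply_eq_zero hω_pos hω_lt hx
      (List.cons_ne_nil i I), mul_zero, zero_smul, add_zero, ih, map_smul,
      rightCreation_simpleBasisVec]

end Center

/-- The assumption dim H > 1 enters here: a second index carries positive weight. -/
theorem weight_lt_one [Nontrivial Θ] (hω_pos : ∀ i, 0 < ω i) (hω_sum : HasSum ω 1) (i : Θ) :
    ω i < 1 := by
  classical
  obtain ⟨j, hj⟩ := exists_ne i
  have := sum_le_hasSum {i, j} (fun k _ => (hω_pos k).le) hω_sum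
  rw [Finset.sum_pair hj.symm] at this
  linarith [hω_pos j]

theorem eq_smul_one_of_central [Nontrivial Θ]
    {P : (FockSpace H →L[ℂ] FockSpace H) →L[ℂ] (FockSpace H →L[ℂ] FockSpace H)}
    (hP : IsKrausMarkov (fun i => leftCreation (e i)) ω P) (he : Orthonormal ℂ e)
    (htot : (Submodule.span ℂ (Set.range e)).topologicalClosure = ⊤)
    (hω_pos : ∀ i, 0 < ω i) {κ : Ultrafilter ℕ} (hκ : (κ : Filter ℕ) ≤ cofinite)
    {x : FockSpace H →L[ℂ] FockSpace H} (hx : x ∈ poissonBoundary P)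
    (hcomm : ∀ y ∈ poissonBoundary P, choiEffros κ P x y = choiEffros κ P y x) :
    x = ⟪vacuum H, x (vacuum H)⟫_ℂ • (1 : FockSpace H →L[ℂ] FockSpace H) := by
  refine eq_smul_one_of_intertwining he htot hω_pos (weight_lt_one hω_pos hP.hasSum_one)
    (fun i => ?_) (fun i => ?_)
  · rw [← choiEffros_rightCreation_right hP hκ (e i) hx, hcomm _ (rightCreation_mem hP (e i)),
      choiEffros_rightCreation_left hP hκ he htot i hx]
  · have hx' := hP.star_mem hx
    -- Commutation of x with r_i* is, after taking adjoints, commutation of x* with r_i.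
    have h := congrArg star (hcomm _ (hP.star_mem (rightCreation_mem hP (e i))))
    rw [star_choiEffros hP, star_choiEffros hP, star_star] at h
    rw [← choiEffros_rightCreation_right hP hκ (e i) hx', ← h,
      choiEffros_rightCreation_left hP hκ he htot i hx']

theorem choiEffros_rightCreation_star_ne_one
    {P : (FockSpace H →L[ℂ] FockSpace H) →L[ℂ] (FockSpace H →L[ℂ] FockSpace H)}
    (hP : IsKrausMarkov (fun i => leftCreation (e i)) ω P) (he : Orthonormal ℂ e)
    (htot : (Submodule.span ℂ (Set.range e)).topologicalClosure = ⊤)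
    {κ : Ultrafilter ℕ} (hκ : (κ : Filter ℕ) ≤ cofinite) {i : Θ} (hi : ω i < 1) :
    choiEffros κ P (rightCreation (e i)) (star (rightCreation (e i))) ≠ 1 := by
  classical
  intro h
  rw [choiEffros_rightCreation_left hP hκ he htot i (hP.star_mem (rightCreation_mem hP (e i))),
    mul_assoc (vacuumProjection H), star_rightCreation_mul_leftCreation he htot, if_pos rfl,
    mul_add, ← mul_assoc (vacuumProjection H), vacuumProjection_mul_leftCreation, zero_mul,
    zero_add] at h
  -- By now the product is r_i r_i* + ω_i p, up to writing p as p p; its vacuum entry is ω_i.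
  have h1 := congrArg (fun T => ⟪vacuum H, T (vacuum H)⟫_ℂ) h
  change ⟪vacuum H, rightCreation (e i) _ +
    (ω i : ℂ) • vacuumProjection H (vacuumProjection H (vacuum H))⟫_ℂ =
      ⟪vacuum H, vacuum H⟫_ℂ at h1
  rw [inner_add_right, inner_vacuum_rightCreation, zero_add, inner_smul_right,
    vacuumProjection_apply, vacuumProjection_apply, inner_vacuum_self, one_smul, inner_vacuum_self,
    one_smul, inner_vacuum_self, mul_one] at h1
  exact hi.ne (by exact_mod_cast h1)

theorem choiEffros_star_rightCreation
    {P : (FockSpace H →L[ℂ] FockSpace H) →L[ℂ] (FockSpace H →L[ℂ] FockSpace H)}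
    (hP : IsKrausMarkov (fun i => leftCreation (e i)) ω P) (he : Orthonormal ℂ e)
    (htot : (Submodule.span ℂ (Set.range e)).topologicalClosure = ⊤)
    {κ : Ultrafilter ℕ} (hκ : (κ : Filter ℕ) ≤ cofinite) (i : Θ) :
    choiEffros κ P (star (rightCreation (e i))) (rightCreation (e i)) = 1 := by
  rw [choiEffros_rightCreation_right hP hκ (e i) (hP.star_mem (rightCreation_mem hP (e i))),
    star_rightCreation_mul he htot]

theorem isFactor_harmonicAlgebra [Nontrivial Θ]
    {P : (FockSpace H →L[ℂ] FockSpace H) →L[ℂ] (FockSpace H →L[ℂ] FockSpace H)}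
    (hP : IsKrausMarkov (fun i => leftCreation (e i)) ω P) (he : Orthonormal ℂ e)
    (htot : (Submodule.span ℂ (Set.range e)).topologicalClosure = ⊤)
    (hω_pos : ∀ i, 0 < ω i) {κ : Ultrafilter ℕ} (hκ : (κ : Filter ℕ) ≤ cofinite) :
    IsFactor (HarmonicAlgebra hP hκ) where
  wstar := HarmonicAlgebra.wStarAlgebra
  nontrivial := by
    refine ⟨1, 0, fun h => ?_⟩
    have h1 := congrArg HarmonicAlgebra.val h
    rw [HarmonicAlgebra.val_one, map_zero] at h1
    have h2 := congrArg (fun T => ‖T (vacuum H)‖) h1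
    simp [norm_vacuum] at h2
  center_eq := by
    refine eq_bot_iff.2 fun x hx => ?_
    rw [Subalgebra.mem_center_iff] at hx
    have h := eq_smul_one_of_central hP he htot hω_pos hκ x.val_mem fun y hy =>
      (congrArg HarmonicAlgebra.val (hx (HarmonicAlgebra.mk y hy))).symm
    refine Algebra.mem_bot.2 ⟨⟪vacuum H, HarmonicAlgebra.val x (vacuum H)⟫_ℂ, ?_⟩
    refine HarmonicAlgebra.ext ?_
    rw [Algebra.algebraMap_eq_smul_one, map_smul, HarmonicAlgebra.val_one]
    exact h.symm

theorem isInfiniteAlgebra_harmonicAlgebra [Nontrivial Θ]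
    {P : (FockSpace H →L[ℂ] FockSpace H) →L[ℂ] (FockSpace H →L[ℂ] FockSpace H)}
    (hP : IsKrausMarkov (fun i => leftCreation (e i)) ω P) (he : Orthonormal ℂ e)
    (htot : (Submodule.span ℂ (Set.range e)).topologicalClosure = ⊤)
    (hω_pos : ∀ i, 0 < ω i) {κ : Ultrafilter ℕ} (hκ : (κ : Filter ℕ) ≤ cofinite) :
    IsInfiniteAlgebra (HarmonicAlgebra hP hκ) := by
  obtain ⟨i⟩ : Nonempty Θ := inferInstance
  refine ⟨HarmonicAlgebra.mk _ (rightCreation_mem hP (e i)), HarmonicAlgebra.ext ?_, fun h => ?_⟩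
  · exact choiEffros_star_rightCreation hP he htot hκ i
  · exact choiEffros_rightCreation_star_ne_one hP he htot hκ
      (weight_lt_one hω_pos hP.hasSum_one i) (congrArg HarmonicAlgebra.val h)

end FockMarkov

end

theorem theorem3 {H : Type u} [NormedAddCommGroup H] [InnerProductSpace ℂ H] [CompleteSpace H]
    {Θ : Type*} [DecidableEq Θ] [Nontrivial Θ] (e : HilbertBasis Θ ℂ H)
    (ω : Θ → ℝ) (hω_pos : ∀ i, 0 < ω i) (hω_sum : HasSum ω 1)
    (κ : Ultrafilter ℕ) (hκ : (κ : Filter ℕ) ≤ Filter.cofinite) :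
    -- the harmonic elements, with the Choi-Effros product and the adjoint and norm of operators,
    -- form a von Neumann algebra, which is an infinite factor
    (∃ (M : Type u) (_ : CStarAlgebra M) (Φ : poissonBoundary (markovOperator e ω) ≃ₗᵢ[ℂ] M),
      (∀ x y : poissonBoundary (markovOperator e ω),
        ((Φ.symm (Φ x * Φ y) : poissonBoundary (markovOperator e ω)) : FockSpace H →L[ℂ] FockSpace H) =
          choiEffros κ (markovOperator e ω) x y) ∧
      (∀ x : poissonBoundary (markovOperator e ω),
        ((Φ.symm (star (Φ x)) : poissonBoundary (markovOperator e ω)) : FockSpace H →L[ℂ] FockSpace H) =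
          star (x : FockSpace H →L[ℂ] FockSpace H)) ∧
      IsFactor M ∧ IsInfiniteAlgebra M) ∧
    -- the matrix entries of the central elements
    (∀ x ∈ poissonBoundary (markovOperator e ω),
      (∀ y ∈ poissonBoundary (markovOperator e ω),
        choiEffros κ (markovOperator e ω) x y = choiEffros κ (markovOperator e ω) y x) →
      (∀ I J : List Θ, ⟪simpleBasisVec e J, x (simpleBasisVec e I)⟫_ℂ =
        if I = J then ⟪vacuum H, x (vacuum H)⟫_ℂ else 0) ∧
      x = ⟪vacuum H, x (vacuum H)⟫_ℂ • (1 : FockSpace H →L[ℂ] FockSpace H)) ∧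
    -- the right creation operators are non-unitary isometries
    (∀ i : Θ, rightCreation (e i) ∈ poissonBoundary (markovOperator e ω) ∧
      star (rightCreation (e i)) ∈ poissonBoundary (markovOperator e ω) ∧
      choiEffros κ (markovOperator e ω) (star (rightCreation (e i))) (rightCreation (e i)) = 1 ∧
      choiEffros κ (markovOperator e ω) (rightCreation (e i)) (star (rightCreation (e i))) ≠ 1) := by
  have he := e.orthonormal
  have htot := e.dense_span
  have hP := isKrausMarkov_markovOperator he (fun i => (hω_pos i).le) hω_sum
  refine ⟨⟨HarmonicAlgebra hP hκ, inferInstance, HarmonicAlgebra.equiv hP hκ, fun x y => rfl,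
    fun x => rfl, isFactor_harmonicAlgebra hP he htot hω_pos hκ,
    isInfiniteAlgebra_harmonicAlgebra hP he htot hω_pos hκ⟩, fun x hx hcomm => ?_, fun i =>
    ⟨rightCreation_mem hP (e i), hP.star_mem (rightCreation_mem hP (e i)),
      choiEffros_star_rightCreation hP he htot hκ i,
      choiEffros_rightCreation_star_ne_one hP he htot hκ (weight_lt_one hω_pos hω_sum i)⟩⟩
  have h := eq_smul_one_of_central hP he htot hω_pos hκ hx hcomm
  refine ⟨fun I J => ?_, h⟩
  rw [h, smul_apply, one_apply_eq_self, inner_smul_right, inner_simpleBasisVec e he, ← h]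
  by_cases hIJ : I = J
  · rw [if_pos hIJ, if_pos hIJ.symm, mul_one]
  · rw [if_neg hIJ, if_neg (Ne.symm hIJ), mul_zero]
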